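/- **Setting.** Let $V$ be a finite-dimensional real vector space, $(\alpha_i)_{i\in I}$ ($I$ finite) a linearly independent family in $V^*$ and $(\alpha_i^\vee)_{i\in I}$ a family in $V$ with $\alpha_i(\alpha_i^\vee)=2$. Let $W^v\subset GL(V)$ be generated by the reflections $r_i(v)=v-\alpha_i(v)\alpha_i^\vee$ and let $\Phi=\{w\alpha_i\mid w\in W^v, i\in I\}$ be the set of real roots. Put $V^*_+=\sum_i\mathbb R_{\ge0}\alpha_i$ and $\Phi^+=\Phi\cap V^*_+$. It is assumed that $W^v$ is a Coxeter group for the generators $r_i$; that $r_\alpha=wr_iw^{-1}$ depends only on $\alpha=w\alpha_i$; that $\Phi=\Phi^+\sqcup-\Phi^+$; that only $1\in W^v$ stabilizes $\Phi^+$; that $w\alpha_i\in\Phi^+\iff\ell(wr_i)>\ell(w)$; and that $\Phi\cap\mathbb R_{\ge0}\alpha=\{\alpha\}$ for $\alpha\in\Phi$. A set $\Delta_{im}\subset V^*$ of imaginary roots is given, disjoint from $\mathbb R\Phi$, stable under $\pm W^v$, such that $\Delta_{im}\subset V^*_+\cup -V^*_+$ and $\Delta_{im}\cap V^*_+$ is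 $W^v$-stable (moderately imaginary case). Put $\Delta=\Phi\cup\Delta_{im}$. The vectorial facets are the sets $\pm wF^v(J)$ ($w\in W^v$, $J\subset I$), where $F^v(J)=\{v\mid \alpha_i(v)=0\ (i\in J),\ \alpha_i(v)>0\ (i\notin J)\}$; those with $J=\emptyset$ are the vectorial chambers, and those with $\langle r_i\mid i\in J\rangle$ finite are called spherical. The Tits cone $\mathcal T$ is the union of the facets $wF^v(J)$. The model apartment $\mathbb A$ is an affine space under $V$ with a set $\mathcal M$ of affine hyperplanes (walls) such that each wall has direction $\ker\alpha$ for some $\alpha\in\Phi$, each $\ker\alpha$ ($\alpha\in\Phi$) is the direction of infinitely many walls, and $\mathcal M$ is stable under the group $W$ generated by the reflections $r_M$ ($M\in\mathcal M$) with linear part $r_\alpha$, $\ker\alpha$ being the direction of $M$. Half-spaces of type $\alpha\in\Delta$ are the sets $\{y\mid\alpha(y-m)\ge0\}$ (closed) and $\{y\mid\alpha(y-m)>0\}$ (open), where, if $\alpha\in\Phi$, the hyperplane $m+\ker\alpha$ must be a wall, and, if $\alpha\in\Delta_{im}$, $m$ is arbitrary; the closed ones with $\alpha\in\Phi$ are the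 half-apartments of $\mathbb A$. Subsets are identified with principal filters. A set contains a filter if it is a member of it, the union of two filters is the filter of their common members, and a map fixes a filter if it fixes some member pointwise. The enclosure $cl(F)$ of a filter $F$ consists of the sets containing a member of $F$ of the form $\bigcap_{\alpha\in\Delta}H_\alpha$, each $H_\alpha$ being $\mathbb A$ or a closed half-space of type $\alpha$. The facet $F(x,F^v)$ is defined in the same way from the germ at $x$ of $x+F^v$, with closed or open half-spaces. The chimney with base a facet $F$ and direction a vectorial facet $F^v$ is $cl(F+F^v)$; it is splayed if $F^v$ is spherical, and solid if the direction of its support (the smallest affine subspace containing it) has a finite pointwise fixator in $W^v$. Its germ consists of the sets containing $cl(F+\xi+F^v)$ for some $\xi\in\overline{F^v}$. The sector germ of direction a vectorial chamber $C^v$ is the filter of the sets containing some $x+C^v$, $x\in\mathbb A$. A germ $]x,y)$ of an interval with $x\ne y$ is preordered if $y-x\in\pm\mathcal T$; a half-line is generic if its direction vectors lie in a spherical vectorial facet. An affine hovel of type $\mathbb A$ is a set $\mathcal I$ covered by a set of subsets (apartments) such that: - (MA1) each apartment $A$ is endowed with a nonempty set $\mathrm{Isom}(\mathbb A,A)$ of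 bijections $\mathbb A\to A$ of the form $\{f_0\circ w\mid w\in W\}$ (this transports all the notions above to $A$; an isomorphism $A\to A'$ is a bijection $\varphi$ such that $\varphi\circ f\in \mathrm{Isom}(\mathbb A,A')$ for $f\in \mathrm{Isom}(\mathbb A,A)$); - (MA2) if $F$ is a point, a germ of a preordered interval, a generic half-line or a solid chimney of an apartment $A$, and $A'$ is an apartment containing $F$, then $A\cap A'$ contains the enclosure $cl_A(F)$ and some isomorphism $A\to A'$ fixes $cl_A(F)$; - (MA3) if $\mathfrak R$ is the germ of a splayed chimney and $F$ is a facet or the germ of a solid chimney (each in some apartment), then some apartment contains $\mathfrak R$ and $F$; - (MA4) if two apartments $A,A'$ contain $\mathfrak R$ and $F$ as in (MA3), then $A\cap A'$ contains $cl_A(\mathfrak R\cup F)$ and some isomorphism $A\to A'$ fixes $cl_A(\mathfrak R\cup F)$. The retraction $\rho_{A,\mathfrak Q}$ of $\mathcal I$ onto an apartment $A$ with centre a sector germ $\mathfrak Q$ of $A$ is the map $\mathcal I\to A$, identity on $A$, with $\rho_{A,\mathfrak Q}(x)=\varphi(x)$ for every apartment $B$ containing $\mathfrak Q$ and $x$ and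 every isomorphism $\varphi:B\to A$ fixing $\mathfrak Q$ (such $B$ and $\varphi$ exist for each $x$). **Proposition.** Let $A_1$ and $A_2$ be two apartments of an affine hovel $\mathcal I$ such that $A_1\cap A_2$ is a half-apartment $D$ (of some apartment). Then there is a sector germ $\mathfrak Q$ of $A_1$ such that the retraction $\rho=\rho_{A_1,\mathfrak Q}$ exists and $\rho(A_2)=D$. -/

import Mathlib

open Filter Topology

noncomputable section

namespace Masure

/-! ### The vectorial data: simple roots, Weyl group, real and imaginary roots -/

/-- Simple roots (a free family in the dual) and simple coroots, indexed by the same set `ι`. -/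
structure RootBase (V : Type*) [AddCommGroup V] [Module ℝ V] (ι : Type*) where
  root : ι → Module.Dual ℝ V
  coroot : ι → V
  linearIndependent : LinearIndependent ℝ root
  root_coroot : ∀ i, root i (coroot i) = 2

/-- The action of `GL(V)` on the dual of `V`. -/
def dualAct {V : Type*} [AddCommGroup V] [Module ℝ V] (w : V ≃ₗ[ℝ] V)
    (f : Module.Dual ℝ V) : Module.Dual ℝ V :=
  f ∘ₗ (w.symm : V →ₗ[ℝ] V)

namespace RootBase

variable {V : Type*} [AddCommGroup V] [Module ℝ V] {ι : Type*} (B : RootBase V ι)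

/-- The simple reflection `v ↦ v - αᵢ(v) αᵢ^∨`. -/
def refl (i : ι) : V ≃ₗ[ℝ] V := Module.reflection (B.root_coroot i)

/-- The vectorial Weyl group `W^v`. -/
def weylGroup : Subgroup (V ≃ₗ[ℝ] V) := Subgroup.closure (Set.range B.refl)

/-- The parabolic subgroup `W^v(J)`. -/
def parabolic (J : Set ι) : Subgroup (V ≃ₗ[ℝ] V) := Subgroup.closure (B.refl '' J)

/-- The set `Φ` of real roots. -/
def realRoots : Set (Module.Dual ℝ V) :=
  {f | ∃ w ∈ B.weylGroup, ∃ i, f = dualAct w (B.root i)}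

/-- The cone of the nonnegative combinations of the simple roots. -/
def posCone [Fintype ι] : Set (Module.Dual ℝ V) :=
  {f | ∃ c : ι → ℝ, (∀ i, 0 ≤ c i) ∧ f = ∑ i, c i • B.root i}

/-- The set `Φ⁺` of positive real roots. -/
def posRoots [Fintype ι] : Set (Module.Dual ℝ V) := B.realRoots ∩ B.posCone

/-- The facet `F^v(J)` of the closed fundamental chamber. -/
def stdFacet (J : Set ι) : Set V :=
  {v | (∀ i ∈ J, B.root i v = 0) ∧ ∀ i, i ∉ J → 0 < B.root i v}

/-- `F` is a positive vectorial facet of type `J`. -/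
def IsPosFacetOfType (J : Set ι) (F : Set V) : Prop :=
  ∃ w ∈ B.weylGroup, F = (fun v => w v) '' B.stdFacet J

/-- `F` is a vectorial facet of type `J`, positive or negative. -/
def IsFacetOfType (J : Set ι) (F : Set V) : Prop :=
  B.IsPosFacetOfType J F ∨ B.IsPosFacetOfType J ((fun v => -v) '' F)

/-- Vectorial facets, of either sign. -/
def IsVFacet (F : Set V) : Prop := ∃ J, B.IsFacetOfType J F

/-- Spherical vectorial facets, of either sign. -/
def IsSphericalVFacet (F : Set V) : Prop :=
  ∃ J, Finite (B.parabolic J) ∧ B.IsFacetOfType J F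

/-- Vectorial chambers, of either sign. -/
def IsVChamber (C : Set V) : Prop := B.IsFacetOfType ∅ C

/-- The Tits cone: the union of the positive vectorial facets. -/
def titsCone : Set V := {v | ∃ J F, B.IsPosFacetOfType J F ∧ v ∈ F}

end RootBase

/-- A root base whose Weyl group is a Coxeter group with the usual properties of roots, together
with a set of imaginary roots, in the moderately imaginary case. -/
structure WeylDatum (V : Type*) [AddCommGroup V] [Module ℝ V] (ι : Type*) [Fintype ι]
    extends RootBase V ι where
  /-- `W^v` is a Coxeter group for the generators `rᵢ`; the entries of the Coxeter matrix
  are then the orders of the products `rᵢ rⱼ` (`0` standing for infinite order). -/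
  coxMatrix : CoxeterMatrix ι
  coxSystem : CoxeterSystem coxMatrix toRootBase.weylGroup
  coxSystem_simple : ∀ i, (coxSystem.simple i : V ≃ₗ[ℝ] V) = toRootBase.refl i
  /-- The reflection attached to a real root `w(αᵢ)` depends only on that root. -/
  refl_unique : ∀ w ∈ toRootBase.weylGroup, ∀ w' ∈ toRootBase.weylGroup, ∀ i j,
    dualAct w (root i) = dualAct w' (root j) →
      w * toRootBase.refl i * w⁻¹ = w' * toRootBase.refl j * w'⁻¹
  /-- Every real root is positive or negative. -/
  pos_or_neg : ∀ f ∈ toRootBase.realRoots, f ∈ toRootBase.posCone ∨ -f ∈ toRootBase.posCone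
  /-- Only the neutral element stabilizes `Φ⁺`. -/
  stabilizer_pos : ∀ w ∈ toRootBase.weylGroup,
    dualAct w '' toRootBase.posRoots = toRootBase.posRoots → w = 1
  length_lt_iff : ∀ (w : toRootBase.weylGroup) (i : ι),
    dualAct (w : V ≃ₗ[ℝ] V) (root i) ∈ toRootBase.posRoots ↔
      coxSystem.length w < coxSystem.length (w * coxSystem.simple i)
  /-- The root system is reduced. -/
  reduced : ∀ f ∈ toRootBase.realRoots, ∀ c : ℝ, 0 ≤ c → c • f ∈ toRootBase.realRoots → c • f = f
  /-- The set `Δ_im` of imaginary roots: disjoint from `ℝΦ` and stable by `± W^v`. -/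
  imRoots : Set (Module.Dual ℝ V)
  im_disjoint : ∀ f ∈ toRootBase.realRoots, ∀ c : ℝ, c • f ∉ imRoots
  im_neg : ∀ f ∈ imRoots, -f ∈ imRoots
  im_weyl : ∀ w ∈ toRootBase.weylGroup, ∀ f ∈ imRoots, dualAct w f ∈ imRoots
  /-- Moderately imaginary: an imaginary root is positive or negative, and the set of the
  positive ones is stable by `W^v`. -/
  im_pos_or_neg : ∀ f ∈ imRoots, f ∈ toRootBase.posCone ∨ -f ∈ toRootBase.posCone
  im_pos_weyl : ∀ w ∈ toRootBase.weylGroup, ∀ f ∈ imRoots, f ∈ toRootBase.posCone →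
    dualAct w f ∈ toRootBase.posCone

namespace WeylDatum

variable {V : Type*} [AddCommGroup V] [Module ℝ V] {ι : Type*} [Fintype ι]

/-- All roots, real or imaginary. -/
def allRoots (D : WeylDatum V ι) : Set (Module.Dual ℝ V) := D.realRoots ∪ D.imRoots

end WeylDatum

/-! ### The model apartment -/

section Affine

variable {V : Type*} [NormedAddCommGroup V] [NormedSpace ℝ V]
  {P : Type*} [AddTorsor V P] {ι : Type*} [Fintype ι]

/-- The affine hyperplane of direction `Ker f` through `m`. -/
def hyperplane (f : Module.Dual ℝ V) (m : P) : AffineSubspace ℝ P :=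
  AffineSubspace.mk' m (LinearMap.ker f)

/-- The closed half-space `{y | f (y - m) ≥ 0}`. -/
def closedHalf (f : Module.Dual ℝ V) (m : P) : Set P := {y | 0 ≤ f (y -ᵥ m)}

/-- The open half-space `{y | f (y - m) > 0}`. -/
def openHalf (f : Module.Dual ℝ V) (m : P) : Set P := {y | 0 < f (y -ᵥ m)}

/-- `g` is the reflection `r_M`: it fixes the hyperplane `M` pointwise and its linear part is the
reflection `w rᵢ w⁻¹` of a real root `w(αᵢ)` whose kernel is the direction of `M`. -/
def RootBase.IsWallReflection (B : RootBase V ι) (M : AffineSubspace ℝ P) (g : P ≃ᵃ[ℝ] P) : Prop :=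
  (∀ p ∈ M, g p = p) ∧ ∃ w ∈ B.weylGroup, ∃ i,
    M.direction = LinearMap.ker (dualAct w (B.root i)) ∧ g.linear = w * B.refl i * w⁻¹

/-- The group generated by the reflections along the members of a set of hyperplanes. -/
def RootBase.affineWeyl (B : RootBase V ι) (walls : Set (AffineSubspace ℝ P)) :
    Subgroup (P ≃ᵃ[ℝ] P) :=
  Subgroup.closure {g | ∃ M ∈ walls, B.IsWallReflection M g}

end Affine

/-- The model affine apartment: an affine space `P` under `V` with its set of real walls.
The imaginary walls are all the hyperplanes whose direction is the kernel of an imaginary root. -/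
structure ModelApartment (V : Type*) [NormedAddCommGroup V] [NormedSpace ℝ V]
    (P : Type*) [AddTorsor V P] (ι : Type*) [Fintype ι] extends WeylDatum V ι where
  walls : Set (AffineSubspace ℝ P)
  wall_direction : ∀ M ∈ walls, ∃ f ∈ toRootBase.realRoots, ∃ m : P, M = hyperplane f m
  infinite_walls : ∀ f ∈ toRootBase.realRoots,
    {M | M ∈ walls ∧ M.direction = LinearMap.ker f}.Infinite
  walls_stable : ∀ g ∈ toRootBase.affineWeyl walls, ∀ M ∈ walls,
    M.map (g : P →ᵃ[ℝ] P) ∈ walls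

namespace ModelApartment

variable {V : Type*} [NormedAddCommGroup V] [NormedSpace ℝ V]
  {P : Type*} [AddTorsor V P] {ι : Type*} [Fintype ι] (𝔸 : ModelApartment V P ι)

/-- The affine Weyl group `W`. -/
def weyl : Subgroup (P ≃ᵃ[ℝ] P) := 𝔸.toRootBase.affineWeyl 𝔸.walls

/-- The hyperplane of direction `Ker f` through `m` is a wall: a real wall if `f` is a real root,
any hyperplane if `f` is an imaginary root. -/
def IsWallAt (f : Module.Dual ℝ V) (m : P) : Prop :=
  (f ∈ 𝔸.realRoots ∧ hyperplane f m ∈ 𝔸.walls) ∨ f ∈ 𝔸.imRoots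

/-- The half-spaces `D(f, k)` with `k ∈ Γ_f ∪ {∞}`. -/
def closedHalves (f : Module.Dual ℝ V) : Set (Set P) :=
  {H | H = Set.univ ∨ ∃ m, 𝔸.IsWallAt f m ∧ H = closedHalf f m}

/-- The half-spaces `D(f, k)` or `D°(f, k)` with `k ∈ Γ_f ∪ {∞}`. -/
def anyHalves (f : Module.Dual ℝ V) : Set (Set P) :=
  {H | H = Set.univ ∨ ∃ m, 𝔸.IsWallAt f m ∧ (H = closedHalf f m ∨ H = openHalf f m)}

/-- `T` is an intersection of members of the families `h f`, one for each root `f`. -/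
def IsInter (h : Module.Dual ℝ V → Set (Set P)) (T : Set P) : Prop :=
  ∃ k : Module.Dual ℝ V → Set P, (∀ f ∈ 𝔸.allRoots, k f ∈ h f) ∧ T = ⋂ f ∈ 𝔸.allRoots, k f

theorem inter_mem_anyHalves (f : Module.Dual ℝ V) {H K : Set P}
    (hH : H ∈ 𝔸.anyHalves f) (hK : K ∈ 𝔸.anyHalves f) : H ∩ K = H ∨ H ∩ K = K := by
  rw [Set.inter_eq_left, Set.inter_eq_right]
  rcases hH with rfl | ⟨m, -, hH⟩
  · exact Or.inr (Set.subset_univ _)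
  rcases hK with rfl | ⟨n, -, hK⟩
  · exact Or.inl (Set.subset_univ _)
  have key : ∀ y : P, f (y -ᵥ m) = f (y -ᵥ n) + f (n -ᵥ m) := fun y => by
    rw [← map_add, vsub_add_vsub_cancel]
  rcases lt_trichotomy (f (n -ᵥ m)) 0 with h | h | h
  · left
    rcases hH with rfl | rfl <;> rcases hK with rfl | rfl <;> intro y hy <;>
      simp only [closedHalf, openHalf, Set.mem_ofPred_eq] at hy ⊢ <;>
      linarith [key y]
  · rcases hH with rfl | rfl
    · right
      rcases hK with rfl | rfl <;> intro y hy <;>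
        simp only [closedHalf, openHalf, Set.mem_ofPred_eq] at hy ⊢ <;>
      linarith [key y]
    · left
      rcases hK with rfl | rfl <;> intro y hy <;>
        simp only [closedHalf, openHalf, Set.mem_ofPred_eq] at hy ⊢ <;>
      linarith [key y]
  · right
    rcases hH with rfl | rfl <;> rcases hK with rfl | rfl <;> intro y hy <;>
      simp only [closedHalf, openHalf, Set.mem_ofPred_eq] at hy ⊢ <;>
      linarith [key y]

theorem closedHalves_subset (f : Module.Dual ℝ V) : 𝔸.closedHalves f ⊆ 𝔸.anyHalves f := by
  rintro H (h | ⟨m, hm, h⟩)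
  · exact Or.inl h
  · exact Or.inr ⟨m, hm, Or.inl h⟩

/-- The filter of the sets containing a member of `F` that is an intersection of members of the
families `h f`, one for each root `f`. -/
def hull (h : Module.Dual ℝ V → Set (Set P)) (h₀ : ∀ f, Set.univ ∈ h f)
    (h₁ : ∀ f, h f ⊆ 𝔸.anyHalves f) (F : Filter P) : Filter P where
  sets := {S | ∃ T ∈ F, 𝔸.IsInter h T ∧ T ⊆ S}
  univ_sets := ⟨Set.univ, univ_mem, ⟨fun _ => Set.univ, fun f _ => h₀ f, by simp⟩, subset_rfl⟩
  sets_of_superset := by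
    rintro S S' ⟨T, hT, hi, hs⟩ hss
    exact ⟨T, hT, hi, hs.trans hss⟩
  inter_sets := by
    rintro S S' ⟨T, hT, ⟨k, hk, rfl⟩, hs⟩ ⟨T', hT', ⟨k', hk', rfl⟩, hs'⟩
    refine ⟨_, inter_mem hT hT', ⟨fun f => k f ∩ k' f, fun f hf => ?_, ?_⟩,
      Set.inter_subset_inter hs hs'⟩
    · rcases 𝔸.inter_mem_anyHalves f (h₁ f (hk f hf)) (h₁ f (hk' f hf)) with e | e
      · exact (congrArg (· ∈ h f) e).mpr (hk f hf)
      · exact (congrArg (· ∈ h f) e).mpr (hk' f hf)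
    · simp only [Set.iInter_inter_distrib]

/-- The enclosure `cl(F)` of a filter. -/
def enclosure (F : Filter P) : Filter P :=
  𝔸.hull 𝔸.closedHalves (fun _ => Or.inl rfl) 𝔸.closedHalves_subset F

/-- The local facet `F^ℓ(x, F^v)`: the germ at `x` of `x + F^v`. -/
def localFacet (x : P) (Fv : Set V) : Filter P := map (fun v => v +ᵥ x) (𝓝[Fv] 0)

/-- The facet `F(x, F^v)`. -/
def facet (x : P) (Fv : Set V) : Filter P :=
  𝔸.hull 𝔸.anyHalves (fun _ => Or.inl rfl) (fun _ => subset_rfl) (localFacet x Fv)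

/-- The filter of the sets containing `S + E` for some `S ∈ F`. -/
def addSet (F : Filter P) (E : Set V) : Filter P :=
  map (fun q : V × P => q.1 +ᵥ q.2) (𝓟 E ×ˢ F)

/-- The chimney `r(F, F^v) = cl(F + F^v)` of base `F` and direction `F^v`. -/
def chimney (F : Filter P) (Fv : Set V) : Filter P := 𝔸.enclosure (addSet F Fv)

/-- The germ of the chimney `r(F, F^v)`: the sets containing one of its shortenings
`cl(F + ξ + F^v)`, with `ξ` in the closure of `F^v` (these shortenings are a filtering decreasing
family). -/
def chimneyGerm (F : Filter P) (Fv : Set V) : Filter P :=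
  ⨅ ξ ∈ closure Fv, 𝔸.enclosure (addSet (map (fun p => ξ +ᵥ p) F) Fv)

/-- The support of a filter: the smallest affine subspace that belongs to it. -/
def support (F : Filter P) : AffineSubspace ℝ P := sInf {E | (E : Set P) ∈ F}

/-- Solidity of a chimney: the direction of its support has a finite fixator in `W^v`. -/
def IsSolid (F : Filter P) : Prop :=
  {w : V ≃ₗ[ℝ] V | w ∈ 𝔸.weylGroup ∧ ∀ v ∈ (support F).direction, w v = v}.Finite

/-- Points, seen as filters. -/
def IsPoint (F : Filter P) : Prop := ∃ x : P, F = pure x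

/-- Germs `]x, x + v)` of preordered intervals. -/
def IsPreorderedIntervalGerm (F : Filter P) : Prop :=
  ∃ (x : P) (v : V), v ≠ 0 ∧ (v ∈ 𝔸.titsCone ∨ -v ∈ 𝔸.titsCone) ∧
    F = map (fun t : ℝ => t • v +ᵥ x) (𝓝[>] 0)

/-- Generic half-lines: the vectorial facet of a direction vector is spherical. -/
def IsGenericHalfLine (F : Filter P) : Prop :=
  ∃ (x : P) (v : V), v ≠ 0 ∧ (∃ Fv, 𝔸.IsSphericalVFacet Fv ∧ v ∈ Fv) ∧
    F = 𝓟 ((fun t : ℝ => t • v +ᵥ x) '' Set.Ici 0)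

/-- Solid chimneys. -/
def IsSolidChimney (F : Filter P) : Prop :=
  ∃ (x : P) (F₀ Fv : Set V), 𝔸.IsVFacet F₀ ∧ 𝔸.IsVFacet Fv ∧
    F = 𝔸.chimney (𝔸.facet x F₀) Fv ∧ 𝔸.IsSolid F

/-- Facets. -/
def IsFacet (F : Filter P) : Prop := ∃ (x : P) (Fv : Set V), 𝔸.IsVFacet Fv ∧ F = 𝔸.facet x Fv

/-- Germs of solid chimneys. -/
def IsSolidChimneyGerm (F : Filter P) : Prop :=
  ∃ (x : P) (F₀ Fv : Set V), 𝔸.IsVFacet F₀ ∧ 𝔸.IsVFacet Fv ∧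
    𝔸.IsSolid (𝔸.chimney (𝔸.facet x F₀) Fv) ∧ F = 𝔸.chimneyGerm (𝔸.facet x F₀) Fv

/-- Germs of splayed chimneys: those whose direction is spherical. -/
def IsSplayedChimneyGerm (F : Filter P) : Prop :=
  ∃ (x : P) (F₀ Fv : Set V), 𝔸.IsVFacet F₀ ∧ 𝔸.IsSphericalVFacet Fv ∧
    F = 𝔸.chimneyGerm (𝔸.facet x F₀) Fv

/-- Germs of sectors: for a vectorial chamber `C`, the sets containing a translate `x + C`
(the intersection of two sectors of direction `C` contains a third one). -/
def IsSectorGerm (F : Filter P) : Prop :=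
  ∃ C : Set V, 𝔸.IsVChamber C ∧ F = ⨅ x : P, 𝓟 ((fun v => v +ᵥ x) '' C)

/-- Half-apartments of the model: `D(f, k)` for a real root `f` and a real wall. -/
def IsHalfApartment (D : Set P) : Prop :=
  ∃ f ∈ 𝔸.realRoots, ∃ m : P, hyperplane f m ∈ 𝔸.walls ∧ D = closedHalf f m

end ModelApartment

/-! ### Affine hovels

A filter on `X` is contained in a set `A` when `A` belongs to it; it is contained in a filter `G`
when it is `≤ G`; the union of two filters is their supremum. A map fixes a filter when it fixes
pointwise a member of it. -/

/-- A set `X` covered by apartments of type `𝔸`. An apartment `A` comes with its set `isom A` of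
isomorphisms from the model, bijections from `P` onto `A` that form one orbit of `W`. -/
structure ApartmentSystem {V : Type*} [NormedAddCommGroup V] [NormedSpace ℝ V]
    {P : Type*} [AddTorsor V P] {ι : Type*} [Fintype ι] (𝔸 : ModelApartment V P ι)
    (X : Type*) where
  apartments : Set (Set X)
  cover : ⋃₀ apartments = Set.univ
  isom : Set X → Set (P → X)
  isom_nonempty : ∀ A ∈ apartments, (isom A).Nonempty
  isom_bijOn : ∀ A ∈ apartments, ∀ f ∈ isom A, Set.BijOn f Set.univ A
  isom_iff : ∀ A ∈ apartments, ∀ f₀ ∈ isom A, ∀ f : P → X,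
    f ∈ isom A ↔ ∃ w ∈ 𝔸.weyl, f = f₀ ∘ w

namespace ApartmentSystem

variable {V : Type*} [NormedAddCommGroup V] [NormedSpace ℝ V]
  {P : Type*} [AddTorsor V P] {ι : Type*} [Fintype ι] {𝔸 : ModelApartment V P ι}
  {X : Type*} (S : ApartmentSystem 𝔸 X)

/-- `φ` restricts to an isomorphism from the apartment `A` onto the apartment `A'`
(its values outside `A` are irrelevant). -/
def IsIso (A A' : Set X) (φ : X → X) : Prop := ∃ f ∈ S.isom A, φ ∘ f ∈ S.isom A'

/-- `F` is, in the apartment `A`, a filter of the kind `K`. -/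
def IsIn (K : Filter P → Prop) (A : Set X) (F : Filter X) : Prop :=
  ∃ f ∈ S.isom A, ∃ G, K G ∧ F = map f G

/-- `F` is a filter of the kind `K` in some apartment. -/
def Is (K : Filter P → Prop) (F : Filter X) : Prop := ∃ A ∈ S.apartments, S.IsIn K A F

/-- The intersection of `A` and `A'` contains the enclosure `cl_A(F)` of `F` in `A`, and there is
an isomorphism from `A` onto `A'` fixing this enclosure. -/
def EnclosureShared (A A' : Set X) (F : Filter X) : Prop :=
  ∀ f ∈ S.isom A, A ∩ A' ∈ map f (𝔸.enclosure (comap f F)) ∧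
    ∃ φ, S.IsIso A A' φ ∧ ∀ᶠ x in map f (𝔸.enclosure (comap f F)), φ x = x

/-- The axioms of an affine hovel, for a covering by apartments of type `𝔸`. -/
structure IsAffineHovel : Prop where
  ma2 : ∀ A ∈ S.apartments, ∀ A' ∈ S.apartments, ∀ F : Filter X,
    (S.IsIn ModelApartment.IsPoint A F ∨ S.IsIn 𝔸.IsPreorderedIntervalGerm A F ∨
      S.IsIn 𝔸.IsGenericHalfLine A F ∨ S.IsIn 𝔸.IsSolidChimney A F) →
    A' ∈ F → S.EnclosureShared A A' F
  ma3 : ∀ R F : Filter X, S.Is 𝔸.IsSplayedChimneyGerm R →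
    (S.Is 𝔸.IsFacet F ∨ S.Is 𝔸.IsSolidChimneyGerm F) →
    ∃ A ∈ S.apartments, A ∈ R ∧ A ∈ F
  ma4 : ∀ R F : Filter X, S.Is 𝔸.IsSplayedChimneyGerm R →
    (S.Is 𝔸.IsFacet F ∨ S.Is 𝔸.IsSolidChimneyGerm F) →
    ∀ A ∈ S.apartments, ∀ A' ∈ S.apartments, A ∈ R → A ∈ F → A' ∈ R → A' ∈ F →
    S.EnclosureShared A A' (R ⊔ F)

/-- Half-apartments of `X`. -/
def IsHalfApartment (D : Set X) : Prop :=
  ∃ A ∈ S.apartments, ∃ f ∈ S.isom A, ∃ H : Set P, 𝔸.IsHalfApartment H ∧ D = f '' H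

/-- `ρ` is the retraction of `X` onto the apartment `A` with centre the filter `R`: the image of `x`
is `φ x` for every apartment `B` containing `R` and `x` and every isomorphism `φ` from `B` onto
`A` fixing `R`, and there are such `B` and `φ`. -/
structure IsRetraction (A : Set X) (R : Filter X) (ρ : X → X) : Prop where
  mem : ∀ x, ρ x ∈ A
  eq_self : ∀ x ∈ A, ρ x = x
  exists_iso : ∀ x, ∃ B ∈ S.apartments, x ∈ B ∧ B ∈ R ∧
    ∃ φ, S.IsIso B A φ ∧ ∀ᶠ y in R, φ y = y
  eq_iso : ∀ x, ∀ B ∈ S.apartments, x ∈ B → B ∈ R →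
    ∀ φ, S.IsIso B A φ → (∀ᶠ y in R, φ y = y) → ρ x = φ x

end ApartmentSystem

end Masure

end

set_option linter.unusedSectionVars false

noncomputable section

namespace Masure

/-! ### Systems of simple roots and their cones -/

section Vector

variable {V : Type*} [AddCommGroup V] [Module ℝ V] {ι : Type*}

/-! Let `D` be the side `α ≥ 0` of the wall through `m`, with `α = w αᵢ`, and let `C` be the
vectorial chamber of `w`. A sector germ of direction `C` lies in `D`, so (MA4) yields charts `f₁`,
`f₂` of `A₁`, `A₂` that agree on `D` and nowhere else. The centre `Q` is the sector germ of `A₁`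
whose direction is the chamber adjacent to `C` along its panel of type `{i}`, on the negative side
of the wall. The retraction then folds `A₂`: with `r` the reflection in the wall, `ρ (f₂ p) = f₁ (r
p)` when `α (p - m) ≤ 0` (`retraction_apply`). Both halves of `A₂` thus land in `D`, which is fixed
pointwise.

The fold is established on the part of the closed cone `m - C` above a level `t` of `α` (`Folded`),
and `t` descends from `0` by induction on the reals (`forall_nonpos_of_steps`). In the inductive
step (`folded_step`), (MA3) puts in one apartment `B'` both `Q` and the germ of a chimney of `A₂`
that runs along the opposite of the panel. A panel is spherical, so this germ is splayed; its base
is a chamber facet, so it has some thickness and meets an interval of levels. If the fold is known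
at one of these levels, `B'` contains the piece already folded (`mem_of_folded`), in particular `m`.
The enclosure of the germ and `m` then brings the cone down to the other levels into `B'`
(`mem_of_panel`).

The charts of `B'` extending `f₁` and `f₂` differ by an element of `W` fixing a panel of the wall,
hence by `1` or `r` (`eq_one_or_eq_rootRefl`). The value `1` would make `f₁` and `f₂` agree outside
`D`. -/

theorem dualAct_apply (w : V ≃ₗ[ℝ] V) (f : Module.Dual ℝ V) (v : V) :
    dualAct w f v = f (w⁻¹ v) := rfl

theorem dualAct_mul (w w' : V ≃ₗ[ℝ] V) (f : Module.Dual ℝ V) :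
    dualAct (w * w') f = dualAct w (dualAct w' f) := by
  ext v
  simp [dualAct_apply, mul_inv_rev]

theorem dualAct_inv_dualAct (w : V ≃ₗ[ℝ] V) (f : Module.Dual ℝ V) :
    dualAct w⁻¹ (dualAct w f) = f := by
  ext v
  simp [dualAct_apply, ← LinearEquiv.mul_apply]

theorem dualAct_dualAct_inv (w : V ≃ₗ[ℝ] V) (f : Module.Dual ℝ V) :
    dualAct w (dualAct w⁻¹ f) = f := by
  ext v
  simp [dualAct_apply]

theorem dualAct_neg (w : V ≃ₗ[ℝ] V) (f : Module.Dual ℝ V) : dualAct w (-f) = -dualAct w f := rfl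

theorem dualAct_sum_smul [Fintype ι] (w : V ≃ₗ[ℝ] V) (c : ι → ℝ) (f : ι → Module.Dual ℝ V) :
    dualAct w (∑ j, c j • f j) = ∑ j, c j • dualAct w (f j) := by
  ext v
  simp [dualAct_apply]

/-- The relatively open face of type `J` of the cone where the forms `γ j` are nonnegative. -/
def facetCone (γ : ι → Module.Dual ℝ V) (J : Set ι) : Set V :=
  {v | (∀ j ∈ J, γ j v = 0) ∧ ∀ j, j ∉ J → 0 < γ j v}

theorem facetCone_nonneg {γ : ι → Module.Dual ℝ V} {J : Set ι} {v : V} (hv : v ∈ facetCone γ J)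
    (j : ι) : 0 ≤ γ j v := by
  by_cases hj : j ∈ J
  · exact (hv.1 j hj).ge
  · exact (hv.2 j hj).le

theorem smul_mem_facetCone {γ : ι → Module.Dual ℝ V} {J : Set ι} {v : V}
    (hv : v ∈ facetCone γ J) {t : ℝ} (ht : 0 < t) : t • v ∈ facetCone γ J :=
  ⟨fun j hj => by simp [hv.1 j hj], fun j hj => by simpa using mul_pos ht (hv.2 j hj)⟩

theorem add_mem_facetCone {γ : ι → Module.Dual ℝ V} {J : Set ι} {v v' : V}
    (hv : v ∈ facetCone γ J) (hv' : v' ∈ facetCone γ J) : v + v' ∈ facetCone γ J :=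
  ⟨fun j hj => by simp [hv.1 j hj, hv'.1 j hj],
    fun j hj => by simpa using add_pos (hv.2 j hj) (hv'.2 j hj)⟩

theorem exists_dual_apply_eq {γ : ι → Module.Dual ℝ V} [FiniteDimensional ℝ V]
    (hγ : LinearIndependent ℝ γ) (a : ι → ℝ) : ∃ v, ∀ j, γ j v = a j := by
  obtain ⟨φ, hφ⟩ := LinearMap.exists_extend ((Module.Basis.span hγ).constr ℝ a)
  refine ⟨(Module.evalEquiv ℝ V).symm φ, fun j => ?_⟩
  rw [Module.apply_evalEquiv_symm_apply, ← (Module.Basis.span hγ).constr_basis ℝ a j, ← hφ]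
  simp [Module.Basis.span_apply]

theorem facetCone_nonempty {γ : ι → Module.Dual ℝ V} [FiniteDimensional ℝ V]
    (hγ : LinearIndependent ℝ γ) (J : Set ι) : (facetCone γ J).Nonempty := by
  classical
  obtain ⟨v, hv⟩ := exists_dual_apply_eq hγ fun j => if j ∈ J then 0 else 1
  exact ⟨v, fun j hj => by simp [hv, hj], fun j hj => by simp [hv, hj]⟩

theorem exists_forall_nonneg_add_mul [Finite ι] (a b : ι → ℝ) (J : Set ι)
    (hb : ∀ j, j ∉ J → 0 < b j) : ∃ N : ℝ, 0 ≤ N ∧ ∀ n ≥ N, ∀ j, j ∉ J → 0 ≤ a j + n * b j := by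
  have := Fintype.ofFinite ι
  -- The absolute value on `b j` keeps the terms with `j ∈ J` nonnegative, so the sum dominates each
  -- ratio.
  refine ⟨∑ j, |a j| / |b j|, Finset.sum_nonneg fun j _ => by positivity, fun n hn j hj => ?_⟩
  have h1 : |a j| / |b j| ≤ n :=
    (Finset.single_le_sum (f := fun j => |a j| / |b j|) (fun j _ => by positivity)
      (Finset.mem_univ j)).trans hn
  have hbj := hb j hj
  rw [abs_of_pos hbj, div_le_iff₀ hbj] at h1
  linarith [neg_abs_le (a j)]

/-! ### Chambers, panels and reflections of the Weyl group. -/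

namespace RootBase

variable (B : RootBase V ι)

/-- The simple roots transformed by `w`. -/
def simple (w : V ≃ₗ[ℝ] V) (j : ι) : Module.Dual ℝ V := dualAct w (B.root j)

theorem simple_linearIndependent (w : V ≃ₗ[ℝ] V) : LinearIndependent ℝ (B.simple w) := by
  have h := B.linearIndependent.map' (LinearEquiv.dualMap w.symm).toLinearMap
    (LinearEquiv.ker _)
  exact h

theorem image_stdFacet (w : V ≃ₗ[ℝ] V) (J : Set ι) :
    (fun v => w v) '' B.stdFacet J = facetCone (B.simple w) J := by
  ext v
  constructor
  · rintro ⟨u, hu, rfl⟩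
    simpa [facetCone, simple, dualAct_apply, RootBase.stdFacet] using hu
  · intro hv
    refine ⟨w⁻¹ v, hv, ?_⟩
    simp

theorem isFacetOfType_facetCone {w : V ≃ₗ[ℝ] V} (hw : w ∈ B.weylGroup) (J : Set ι) :
    B.IsFacetOfType J (facetCone (B.simple w) J) :=
  Or.inl ⟨w, hw, (B.image_stdFacet w J).symm⟩

theorem isFacetOfType_facetCone_neg {w : V ≃ₗ[ℝ] V} (hw : w ∈ B.weylGroup) (J : Set ι) :
    B.IsFacetOfType J (facetCone (-B.simple w) J) := by
  refine Or.inr ⟨w, hw, ?_⟩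
  rw [B.image_stdFacet]
  ext v
  constructor
  · rintro ⟨u, hu, rfl⟩
    simpa [facetCone] using hu
  · intro hv
    exact ⟨-v, by simpa [facetCone] using hv, neg_neg v⟩

theorem refl_mem (i : ι) : B.refl i ∈ B.weylGroup := Subgroup.subset_closure ⟨i, rfl⟩

theorem refl_apply (i : ι) (v : V) : B.refl i v = v - B.root i v • B.coroot i :=
  Module.reflection_apply _ _

theorem refl_inv (i : ι) : (B.refl i)⁻¹ = B.refl i := by
  rw [inv_eq_iff_mul_eq_one]
  ext v
  exact Module.involutive_reflection (B.root_coroot i) v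

theorem root_refl (i : ι) (v : V) : B.root i (B.refl i v) = -B.root i v := by
  rw [refl_apply, map_sub, map_smul, B.root_coroot, smul_eq_mul]
  ring

theorem finite_parabolic_empty : Finite (B.parabolic ∅) := by
  rw [parabolic, Set.image_empty, Subgroup.closure_empty]
  infer_instance

theorem finite_parabolic_singleton (i : ι) : Finite (B.parabolic {i}) := by
  rw [parabolic, Set.image_singleton, ← Subgroup.zpowers_eq_closure]
  have h : IsOfFinOrder (B.refl i) := by
    refine isOfFinOrder_iff_pow_eq_one.2 ⟨2, by norm_num, ?_⟩
    rw [pow_two]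
    nth_rewrite 1 [← B.refl_inv i]
    simp
  exact finite_zpowers.2 h

/-- The reflection `r_α` of the real root `α = w (αᵢ)`. -/
def rootRefl (w : V ≃ₗ[ℝ] V) (i : ι) : V ≃ₗ[ℝ] V := w * B.refl i * w⁻¹

theorem rootRefl_mem {w : V ≃ₗ[ℝ] V} (hw : w ∈ B.weylGroup) (i : ι) :
    B.rootRefl w i ∈ B.weylGroup :=
  mul_mem (mul_mem hw (B.refl_mem i)) (inv_mem hw)

theorem simple_rootRefl (w : V ≃ₗ[ℝ] V) (i : ι) (v : V) :
    B.simple w i (B.rootRefl w i v) = -B.simple w i v := by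
  simp only [simple, dualAct_apply, rootRefl, ← LinearEquiv.mul_apply, mul_assoc,
    inv_mul_cancel_left]
  rw [LinearEquiv.mul_apply, root_refl]

theorem rootRefl_of_simple_eq_zero (w : V ≃ₗ[ℝ] V) (i : ι) {v : V} (hv : B.simple w i v = 0) :
    B.rootRefl w i v = v := by
  simp only [simple, dualAct_apply] at hv
  simp only [rootRefl, LinearEquiv.mul_apply, refl_apply, hv, zero_smul, sub_zero]
  simp

/-- The simple system adjacent to the one of `w` along the `i`-th wall. -/
theorem simple_mul_refl_rootRefl (w : V ≃ₗ[ℝ] V) (i j : ι) (v : V) :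
    B.simple (w * B.refl i) j (B.rootRefl w i v) = B.simple w j v := by
  simp only [simple, dualAct_apply, rootRefl, ← LinearEquiv.mul_apply, mul_assoc, mul_inv_rev,
    inv_mul_cancel_left]

theorem simple_mul_refl_self (w : V ≃ₗ[ℝ] V) (i : ι) (v : V) :
    B.simple (w * B.refl i) i v = -B.simple w i v := by
  simp only [simple, dualAct_apply, mul_inv_rev, refl_inv, LinearEquiv.mul_apply, root_refl]

theorem simple_mul_refl_of_eq_zero (w : V ≃ₗ[ℝ] V) (i j : ι) {v : V} (hv : B.simple w i v = 0) :
    B.simple (w * B.refl i) j v = B.simple w j v := by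
  conv_lhs => rw [← B.rootRefl_of_simple_eq_zero w i hv]
  exact B.simple_mul_refl_rootRefl w i j v

theorem simple_mem_realRoots {w : V ≃ₗ[ℝ] V} (hw : w ∈ B.weylGroup) (j : ι) :
    B.simple w j ∈ B.realRoots := ⟨w, hw, j, rfl⟩

theorem dualAct_mem_realRoots {w : V ≃ₗ[ℝ] V} (hw : w ∈ B.weylGroup) {f : Module.Dual ℝ V}
    (hf : f ∈ B.realRoots) : dualAct w f ∈ B.realRoots := by
  obtain ⟨w', hw', i, rfl⟩ := hf
  exact ⟨w * w', mul_mem hw hw', i, (dualAct_mul _ _ _).symm⟩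

/-- A nonnegative combination of simple roots that vanishes on a vector of the panel of type
`{i}` is a multiple of the `i`-th simple root. -/
theorem eq_smul_of_apply_nonpos [Fintype ι] {γ : ι → Module.Dual ℝ V} {c : ι → ℝ}
    (hc : ∀ j, 0 ≤ c j) {i : ι} {v : V} (hv : v ∈ facetCone γ {i})
    (h : (∑ j, c j • γ j) v ≤ 0) : ∑ j, c j • γ j = c i • γ i := by
  refine Finset.sum_eq_single i (fun j _ hj => ?_) (by simp)
  have hnn : ∀ k ∈ Finset.univ, 0 ≤ c k * γ k v := fun k _ =>
    mul_nonneg (hc k) (facetCone_nonneg hv k)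
  have h0 : ∑ k, c k * γ k v = 0 :=
    le_antisymm (by simpa [LinearMap.sum_apply] using h) (Finset.sum_nonneg hnn)
  have h1 := (Finset.sum_eq_zero_iff_of_nonneg hnn).1 h0 j (Finset.mem_univ j)
  have h2 : c j = 0 := (mul_eq_zero.1 h1).resolve_right (hv.2 j (by simpa using hj)).ne'
  simp [h2]

end RootBase

/-! ### Signs of the roots and fixators of panels. -/

namespace WeylDatum

variable [Fintype ι] (D : WeylDatum V ι)

/-- Every root is, up to sign, a nonnegative combination of the simple roots of `w`. -/
theorem allRoots_sign {w : V ≃ₗ[ℝ] V} (hw : w ∈ D.weylGroup) {β : Module.Dual ℝ V}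
    (hβ : β ∈ D.allRoots) : ∃ c : ι → ℝ, (∀ j, 0 ≤ c j) ∧
      (β = ∑ j, c j • D.simple w j ∨ -β = ∑ j, c j • D.simple w j) := by
  have h : dualAct w⁻¹ β ∈ D.posCone ∨ -dualAct w⁻¹ β ∈ D.posCone := by
    rcases hβ with hβ | hβ
    · exact D.pos_or_neg _ (D.dualAct_mem_realRoots (inv_mem hw) hβ)
    · exact D.im_pos_or_neg _ (D.im_weyl _ (inv_mem hw) _ hβ)
  rcases h with ⟨c, hc, h⟩ | ⟨c, hc, h⟩
  · refine ⟨c, hc, Or.inl ?_⟩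
    rw [← dualAct_dualAct_inv w β, h, dualAct_sum_smul]
    rfl
  · refine ⟨c, hc, Or.inr ?_⟩
    rw [← dualAct_dualAct_inv w β, ← dualAct_neg, h, dualAct_sum_smul]
    rfl

/-- Such a `g` preserves `Φ⁺`. If `β` is positive and `g β` negative, evaluation at a point of the
panel forces `β` to vanish there; then `β` is proportional to `αᵢ`, which `g` fixes, so `g β = β`
after all. -/
theorem eq_one_of_fixes_panel_of_fixes_root [FiniteDimensional ℝ V] {g : V ≃ₗ[ℝ] V}
    (hg : g ∈ D.weylGroup) {i : ι} (hfix : ∀ v ∈ facetCone D.root {i}, g v = v)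
    (hroot : dualAct g (D.root i) = D.root i) : g = 1 := by
  obtain ⟨v, hv⟩ := facetCone_nonempty D.linearIndependent {i}
  have key : ∀ g ∈ D.weylGroup, g v = v → dualAct g (D.root i) = D.root i →
      ∀ β ∈ D.posRoots, dualAct g β ∈ D.posRoots := by
    rintro g hg hgv hgi β ⟨hβ, c, hc, hβc⟩
    refine ⟨D.dualAct_mem_realRoots hg hβ, ?_⟩
    rcases D.pos_or_neg _ (D.dualAct_mem_realRoots hg hβ) with h | ⟨d, hd, h⟩
    · exact h
    · have hginv : g⁻¹ v = v := by
        conv_lhs => rw [← hgv]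
        simp [← LinearEquiv.mul_apply]
      have h1 : dualAct g β v = β v := by rw [dualAct_apply, hginv]
      have h2 : 0 ≤ (-dualAct g β) v := by
        rw [h, LinearMap.sum_apply]
        exact Finset.sum_nonneg fun j _ => mul_nonneg (hd j) (facetCone_nonneg hv j)
      have h3 : β = c i • D.root i := by
        rw [hβc]
        refine RootBase.eq_smul_of_apply_nonpos hc hv ?_
        rw [← hβc, ← h1]
        simpa using h2
      have h4 : dualAct g β = β := by
        rw [h3]
        ext u
        have := LinearMap.congr_fun hgi u
        simp only [dualAct_apply, LinearMap.smul_apply] at this ⊢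
        rw [this]
      rw [h4]
      exact ⟨c, hc, hβc⟩
  have hgv := hfix v hv
  refine D.stabilizer_pos g hg (Set.Subset.antisymm ?_ fun β hβ => ?_)
  · rintro _ ⟨β, hβ, rfl⟩
    exact key g hg hgv hroot β hβ
  · refine ⟨dualAct g⁻¹ β, key g⁻¹ (inv_mem hg) ?_ ?_ β hβ, dualAct_dualAct_inv g β⟩
    · conv_lhs => rw [← hgv]
      simp [← LinearEquiv.mul_apply]
    · conv_lhs => rw [← hroot]
      exact dualAct_inv_dualAct g _

/-- The pointwise fixator of a panel consists of `1` and a reflection. -/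
theorem eq_one_or_eq_rootRefl [FiniteDimensional ℝ V] {w g : V ≃ₗ[ℝ] V} (hw : w ∈ D.weylGroup)
    (hg : g ∈ D.weylGroup) {i : ι} (hfix : ∀ v ∈ facetCone (D.simple w) {i}, g v = v) :
    g = 1 ∨ g = D.rootRefl w i := by
  have hk : w⁻¹ * g * w ∈ D.weylGroup := mul_mem (mul_mem (inv_mem hw) hg) hw
  have hkfix : ∀ v ∈ facetCone D.root {i}, (w⁻¹ * g * w) v = v := by
    intro v hv
    have : w v ∈ facetCone (D.simple w) {i} := by
      rw [← D.image_stdFacet]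
      exact ⟨v, hv, rfl⟩
    rw [LinearEquiv.mul_apply, LinearEquiv.mul_apply, hfix _ this]
    simp [← LinearEquiv.mul_apply]
  generalize hkdef : w⁻¹ * g * w = k at hk hkfix
  have hgk : g = w * k * w⁻¹ := by rw [← hkdef]; group
  have hreflfix : ∀ v ∈ facetCone D.root {i}, D.refl i v = v := by
    intro v hv
    rw [D.refl_apply, hv.1 i rfl, zero_smul, sub_zero]
  obtain ⟨v, hv⟩ := facetCone_nonempty D.linearIndependent {i}
  have hkinv : k⁻¹ v = v := by
    conv_lhs => rw [← hkfix v hv]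
    simp [← LinearEquiv.mul_apply]
  have hval : dualAct k (D.root i) v = 0 := by
    rw [dualAct_apply, hkinv]
    exact hv.1 i rfl
  have hneg : dualAct (k * D.refl i) (D.root i) = -dualAct k (D.root i) := by
    ext u
    simp only [dualAct_apply, mul_inv_rev, RootBase.refl_inv, LinearEquiv.mul_apply,
      RootBase.root_refl, LinearMap.neg_apply]
  have hri : D.root i ∈ D.realRoots := ⟨1, one_mem _, i, rfl⟩
  -- The root `k αᵢ` vanishes on the panel, so it is proportional to `αᵢ`; the root system being
  -- reduced, it is `αᵢ` or `-αᵢ`. In the second case `k rᵢ` fixes both the panel and `αᵢ`.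
  rcases D.pos_or_neg _ (D.dualAct_mem_realRoots hk hri) with ⟨c, hc, h⟩ | ⟨c, hc, h⟩
  · left
    have h1 : dualAct k (D.root i) = c i • D.root i := by
      rw [h]
      refine RootBase.eq_smul_of_apply_nonpos hc hv ?_
      rw [← h, hval]
    have h2 := D.reduced _ hri (c i) (hc i) (h1 ▸ D.dualAct_mem_realRoots hk hri)
    rw [hgk, D.eq_one_of_fixes_panel_of_fixes_root hk hkfix (h1.trans h2)]
    simp
  · right
    have h1 : dualAct (k * D.refl i) (D.root i) = c i • D.root i := by
      rw [hneg, h]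
      refine RootBase.eq_smul_of_apply_nonpos hc hv ?_
      rw [← h, LinearMap.neg_apply, hval, neg_zero]
    have hkr : k * D.refl i ∈ D.weylGroup := mul_mem hk (D.refl_mem i)
    have h2 := D.reduced _ hri (c i) (hc i) (h1 ▸ D.dualAct_mem_realRoots hkr hri)
    have h3 : k * D.refl i = 1 := D.eq_one_of_fixes_panel_of_fixes_root hkr
      (fun u hu => by rw [LinearEquiv.mul_apply, hreflfix u hu, hkfix u hu]) (h1.trans h2)
    rw [hgk, mul_eq_one_iff_eq_inv.1 h3, D.refl_inv]
    rfl

end WeylDatum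

end Vector

end Masure

end

noncomputable section

namespace Masure

/-! ### Topology of the cones -/

section Cones

variable {V : Type*} [NormedAddCommGroup V] [NormedSpace ℝ V] {ι : Type*}

theorem add_mem_closure_facetCone {γ : ι → Module.Dual ℝ V} {J : Set ι} {ξ ξ' : V}
    (hξ : ξ ∈ closure (facetCone γ J)) (hξ' : ξ' ∈ closure (facetCone γ J)) :
    ξ + ξ' ∈ closure (facetCone γ J) :=
  map_mem_closure₂ continuous_add hξ hξ' fun _ ha _ hb => add_mem_facetCone ha hb

theorem tendsto_smul_zero (v : V) : Tendsto (fun t : ℝ => t • v) (𝓝[>] 0) (𝓝 0) := by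
  have : Tendsto (fun t : ℝ => t • v) (𝓝 0) (𝓝 ((0 : ℝ) • v)) :=
    (continuous_id.smul continuous_const).tendsto 0
  rw [zero_smul] at this
  exact this.mono_left nhdsWithin_le_nhds

theorem zero_mem_closure_facetCone {γ : ι → Module.Dual ℝ V} {J : Set ι}
    (h : (facetCone γ J).Nonempty) : (0 : V) ∈ closure (facetCone γ J) := by
  obtain ⟨v, hv⟩ := h
  exact mem_closure_of_tendsto (tendsto_smul_zero v)
    (eventually_mem_nhdsWithin.mono fun t ht => smul_mem_facetCone hv ht)

/-- A linear property stable by scaling that holds for the differences of points of a nonempty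
open set holds everywhere. -/
theorem forall_of_isOpen {p : V → Prop} (hp : ∀ (t : ℝ) v, t ≠ 0 → p (t • v) → p v) {O : Set V}
    (hO : IsOpen O) {y : V} (hy : y ∈ O) (h : ∀ v, y + v ∈ O → p v) (v : V) : p v := by
  have h1 : ∀ᶠ t in 𝓝[>] (0 : ℝ), y + t • v ∈ O := by
    have : Tendsto (fun t : ℝ => y + t • v) (𝓝[>] 0) (𝓝 (y + 0)) :=
      tendsto_const_nhds.add (tendsto_smul_zero v)
    rw [add_zero] at this
    exact this.eventually_mem (hO.mem_nhds hy)
  obtain ⟨t, ht, ht0⟩ := (h1.and eventually_mem_nhdsWithin).exists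
  exact hp t v (ne_of_gt ht0) (h _ ht)

variable [FiniteDimensional ℝ V]

theorem continuous_dual (f : Module.Dual ℝ V) : Continuous f :=
  LinearMap.continuous_of_finiteDimensional f

theorem closure_facetCone_subset (γ : ι → Module.Dual ℝ V) (J : Set ι) :
    closure (facetCone γ J) ⊆ {v | (∀ j ∈ J, γ j v = 0) ∧ ∀ j, 0 ≤ γ j v} := by
  refine closure_minimal (fun v hv => ⟨hv.1, facetCone_nonneg hv⟩) ?_
  have h1 : IsClosed {v | ∀ j ∈ J, γ j v = 0} := by
    simp only [Set.ofPred_forall]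
    exact isClosed_iInter fun j => isClosed_iInter fun _ =>
      isClosed_eq (continuous_dual _) continuous_const
  have h2 : IsClosed {v | ∀ j, 0 ≤ γ j v} := by
    simp only [Set.ofPred_forall]
    exact isClosed_iInter fun j => isClosed_le continuous_const (continuous_dual _)
  exact h1.inter h2

theorem closure_add_mem_facetCone {γ : ι → Module.Dual ℝ V} {J : Set ι} {ξ v : V}
    (hξ : ξ ∈ closure (facetCone γ J)) (hv : v ∈ facetCone γ J) : ξ + v ∈ facetCone γ J := by
  obtain ⟨h1, h2⟩ := closure_facetCone_subset γ J hξ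
  exact ⟨fun j hj => by simp [h1 j hj, hv.1 j hj],
    fun j hj => by simpa using add_pos_of_nonneg_of_pos (h2 j) (hv.2 j hj)⟩

theorem isOpen_facetCone_empty [Finite ι] (γ : ι → Module.Dual ℝ V) :
    IsOpen (facetCone γ ∅) := by
  have : facetCone γ ∅ = ⋂ j, {v | 0 < γ j v} := by
    ext v
    simp [facetCone]
  rw [this]
  exact isOpen_iInter_of_finite fun j => isOpen_lt continuous_const (continuous_dual _)

variable {P : Type*} [AddTorsor V P]

theorem affineEquiv_eq_one_of_isOpen {u : P ≃ᵃ[ℝ] P} {x : P} {O : Set V} (hO : IsOpen O)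
    (hne : O.Nonempty) (h : ∀ y ∈ O, u (y +ᵥ x) = y +ᵥ x) : u = 1 := by
  obtain ⟨y, hy⟩ := hne
  have hlin : ∀ v, u.linear v = v := by
    refine forall_of_isOpen (p := fun v => u.linear v = v) (fun t v ht h => ?_) hO hy fun v hv => ?_
    · rw [map_smul] at h
      exact smul_right_injective V ht h
    · have h1 := h _ hv
      rw [add_comm, add_vadd, AffineEquiv.map_vadd, h y hy] at h1
      exact vadd_right_cancel _ h1
  ext p
  have : p = (p -ᵥ (y +ᵥ x)) +ᵥ (y +ᵥ x) := (vsub_vadd _ _).symm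
  rw [this, AffineEquiv.map_vadd, hlin, h y hy]
  rfl

theorem affineSubspace_eq_top_of_isOpen {E : AffineSubspace ℝ P} {x : P} {O : Set V}
    (hO : IsOpen O) (hne : O.Nonempty) (h : ∀ y ∈ O, y +ᵥ x ∈ E) : E = ⊤ := by
  obtain ⟨y, hy⟩ := hne
  have hdir : ∀ v, v ∈ E.direction := by
    refine forall_of_isOpen (fun t v ht h => ?_) hO hy fun v hv => ?_
    · exact (E.direction.smul_mem_iff ht).1 h
    · have h1 := AffineSubspace.vsub_mem_direction (h _ hv) (h _ hy)
      rwa [vadd_vsub_vadd_cancel_right, add_sub_cancel_left] at h1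
  refine (AffineSubspace.direction_eq_top_iff_of_nonempty ⟨_, h y hy⟩).1 ?_
  exact (Submodule.eq_top_iff'.2 hdir)

end Cones

/-! ### Walls, sector germs and chimneys of the model apartment -/

namespace ModelApartment

variable {V : Type*} [NormedAddCommGroup V] [NormedSpace ℝ V]
  {P : Type*} [AddTorsor V P] {ι : Type*} [Fintype ι] (𝔸 : ModelApartment V P ι)

theorem linear_mem_weylGroup {u : P ≃ᵃ[ℝ] P} (hu : u ∈ 𝔸.weyl) : u.linear ∈ 𝔸.weylGroup := by
  have : 𝔸.weyl ≤ 𝔸.weylGroup.comap (AffineEquiv.linearHom : (P ≃ᵃ[ℝ] P) →* _) := by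
    refine (Subgroup.closure_le _).2 ?_
    rintro g ⟨M, -, -, w, hw, i, -, hg⟩
    change g.linear ∈ 𝔸.weylGroup
    rw [hg]
    exact 𝔸.rootRefl_mem hw i
  exact this hu

theorem hyperplane_eq_of_mem {f : Module.Dual ℝ V} {M : AffineSubspace ℝ P} {m : P}
    (hm : m ∈ M) (hM : M.direction = LinearMap.ker f) : M = hyperplane f m := by
  rw [hyperplane, ← hM, AffineSubspace.mk'_eq hm]

/-- The reflection along the wall of direction `Ker (w αᵢ)` through `m`. -/
def wallRefl (w : V ≃ₗ[ℝ] V) (i : ι) (m : P) : P ≃ᵃ[ℝ] P :=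
  AffineEquiv.mk' (fun p => 𝔸.rootRefl w i (p -ᵥ m) +ᵥ m) (𝔸.rootRefl w i) m
    fun p => by simp

theorem wallRefl_apply (w : V ≃ₗ[ℝ] V) (i : ι) (m p : P) :
    𝔸.wallRefl w i m p = 𝔸.rootRefl w i (p -ᵥ m) +ᵥ m := rfl

theorem wallRefl_mem {w : V ≃ₗ[ℝ] V} (hw : w ∈ 𝔸.weylGroup) {i : ι} {m : P}
    (hm : hyperplane (𝔸.simple w i) m ∈ 𝔸.walls) : 𝔸.wallRefl w i m ∈ 𝔸.weyl := by
  refine Subgroup.subset_closure ⟨_, hm, fun p hp => ?_, w, hw, i, ?_, rfl⟩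
  · rw [hyperplane, AffineSubspace.mem_mk', LinearMap.mem_ker] at hp
    rw [wallRefl_apply, 𝔸.rootRefl_of_simple_eq_zero w i hp, vsub_vadd]
  · exact AffineSubspace.direction_mk' _ _

theorem hyperplane_wallRefl_mem {w : V ≃ₗ[ℝ] V} (hw : w ∈ 𝔸.weylGroup) {i : ι} {m n : P}
    (hm : hyperplane (𝔸.simple w i) m ∈ 𝔸.walls) (hn : hyperplane (𝔸.simple w i) n ∈ 𝔸.walls) :
    hyperplane (𝔸.simple w i) (𝔸.wallRefl w i m n) ∈ 𝔸.walls := by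
  have h := 𝔸.walls_stable _ (𝔸.wallRefl_mem hw hm) _ hn
  suffices hdir : (AffineSubspace.map (𝔸.wallRefl w i m : P →ᵃ[ℝ] P)
      (hyperplane (𝔸.simple w i) n)).direction = LinearMap.ker (𝔸.simple w i) by
    have hmem := AffineSubspace.mem_map_of_mem (𝔸.wallRefl w i m : P →ᵃ[ℝ] P)
      (AffineSubspace.self_mem_mk' n (LinearMap.ker (𝔸.simple w i)))
    exact hyperplane_eq_of_mem hmem hdir ▸ h
  rw [AffineSubspace.map_direction, hyperplane, AffineSubspace.direction_mk']
  change Submodule.map (𝔸.rootRefl w i : V →ₗ[ℝ] V) _ = _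
  ext v
  simp only [Submodule.mem_map, LinearMap.mem_ker, LinearEquiv.coe_coe]
  constructor
  · rintro ⟨u, hu, rfl⟩
    rw [𝔸.simple_rootRefl, hu, neg_zero]
  · intro hv
    exact ⟨v, hv, 𝔸.rootRefl_of_simple_eq_zero w i hv⟩

/-- The walls of a given real direction are unbounded in both directions. -/
theorem exists_wall_gt {w : V ≃ₗ[ℝ] V} (hw : w ∈ 𝔸.weylGroup) (i : ι) (y : P) (r : ℝ) :
    (∃ m, hyperplane (𝔸.simple w i) m ∈ 𝔸.walls ∧ r < 𝔸.simple w i (m -ᵥ y)) ∧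
      ∃ m, hyperplane (𝔸.simple w i) m ∈ 𝔸.walls ∧ 𝔸.simple w i (m -ᵥ y) < r := by
  set α := 𝔸.simple w i with hα
  have hinf := 𝔸.infinite_walls α (𝔸.simple_mem_realRoots hw i)
  have hform : ∀ M ∈ {M | M ∈ 𝔸.walls ∧ M.direction = LinearMap.ker α},
      ∃ m, M = hyperplane α m := by
    rintro M ⟨hM, hdir⟩
    obtain ⟨g, -, m, rfl⟩ := 𝔸.wall_direction M hM
    exact ⟨m, hyperplane_eq_of_mem (AffineSubspace.self_mem_mk' m _) hdir⟩
  obtain ⟨M₁, hM₁, M₂, hM₂, hne⟩ := hinf.nontrivial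
  obtain ⟨m₁, rfl⟩ := hform M₁ hM₁
  obtain ⟨m₂, rfl⟩ := hform M₂ hM₂
  have hval : α (m₁ -ᵥ y) ≠ α (m₂ -ᵥ y) := by
    intro h
    refine hne (hyperplane_eq_of_mem (f := α) ?_ (AffineSubspace.direction_mk' _ _))
    rw [hyperplane, AffineSubspace.mem_mk', LinearMap.mem_ker,
      ← vsub_sub_vsub_cancel_right m₂ m₁ y, map_sub, h, sub_self]
  -- Reflecting one wall in another gives a third. From two distinct parallel walls, iteration
  -- produces an arithmetic progression of levels, unbounded in the direction chosen by the order of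
  -- the two.
  have hstep : ∀ m n : P, hyperplane α m ∈ 𝔸.walls → hyperplane α n ∈ 𝔸.walls →
      ∃ q, hyperplane α q ∈ 𝔸.walls ∧ α (q -ᵥ y) = 2 * α (m -ᵥ y) - α (n -ᵥ y) := by
    intro m n hm hn
    refine ⟨_, 𝔸.hyperplane_wallRefl_mem hw hm hn, ?_⟩
    rw [wallRefl_apply, vadd_vsub_assoc, map_add, hα, 𝔸.simple_rootRefl,
      ← vsub_sub_vsub_cancel_right n m y, map_sub]
    ring
  have hprog : ∀ m n : P, hyperplane α m ∈ 𝔸.walls → hyperplane α n ∈ 𝔸.walls → ∀ k : ℕ,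
      (∃ q, hyperplane α q ∈ 𝔸.walls ∧
        α (q -ᵥ y) = α (m -ᵥ y) + k * (α (n -ᵥ y) - α (m -ᵥ y))) ∧
      ∃ q, hyperplane α q ∈ 𝔸.walls ∧
        α (q -ᵥ y) = α (m -ᵥ y) + (k + 1) * (α (n -ᵥ y) - α (m -ᵥ y)) := by
    intro m n hm hn k
    induction k with
    | zero => exact ⟨⟨m, hm, by simp⟩, ⟨n, hn, by simp⟩⟩
    | succ k ih =>
      obtain ⟨⟨q, hq, hqv⟩, ⟨q', hq', hqv'⟩⟩ := ih
      obtain ⟨q'', hq'', hqv''⟩ := hstep q' q hq' hq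
      refine ⟨⟨q', hq', by rw [hqv']; push_cast; ring⟩, ⟨q'', hq'', ?_⟩⟩
      rw [hqv'', hqv, hqv']
      push_cast
      ring
  have hup : ∀ m n : P, hyperplane α m ∈ 𝔸.walls → hyperplane α n ∈ 𝔸.walls →
      α (m -ᵥ y) < α (n -ᵥ y) → (∃ q, hyperplane α q ∈ 𝔸.walls ∧ r < α (q -ᵥ y)) ∧
        ∃ q, hyperplane α q ∈ 𝔸.walls ∧ α (q -ᵥ y) < r := by
    intro m n hm hn hlt
    constructor
    · obtain ⟨k, hk⟩ := exists_nat_gt ((r - α (m -ᵥ y)) / (α (n -ᵥ y) - α (m -ᵥ y)))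
      obtain ⟨⟨q, hq, hqv⟩, -⟩ := hprog m n hm hn k
      refine ⟨q, hq, ?_⟩
      rw [div_lt_iff₀ (sub_pos.2 hlt)] at hk
      linarith
    · obtain ⟨k, hk⟩ := exists_nat_gt ((α (n -ᵥ y) - r) / (α (n -ᵥ y) - α (m -ᵥ y)))
      obtain ⟨⟨q, hq, hqv⟩, -⟩ := hprog n m hn hm k
      refine ⟨q, hq, ?_⟩
      rw [div_lt_iff₀ (sub_pos.2 hlt)] at hk
      linarith
  rcases lt_or_gt_of_ne hval with h | h
  · exact hup _ _ hM₁.1 hM₂.1 h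
  · exact hup _ _ hM₂.1 hM₁.1 h

variable {𝔸}

/-! ### Enclosures, local facets and sector germs as filters. -/

theorem le_hull {h : Module.Dual ℝ V → Set (Set P)} {h₀ : ∀ f, Set.univ ∈ h f}
    {h₁ : ∀ f, h f ⊆ 𝔸.anyHalves f} (F : Filter P) : F ≤ 𝔸.hull h h₀ h₁ F := by
  rintro S ⟨T, hT, -, hTS⟩
  exact mem_of_superset hT hTS

theorem mem_enclosure {F : Filter P} {S : Set P} :
    S ∈ 𝔸.enclosure F ↔ ∃ T ∈ F, 𝔸.IsInter 𝔸.closedHalves T ∧ T ⊆ S := Iff.rfl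

theorem le_enclosure (F : Filter P) : F ≤ 𝔸.enclosure F := le_hull F

theorem mem_facet {x : P} {Fv : Set V} {S : Set P} :
    S ∈ 𝔸.facet x Fv ↔ ∃ T ∈ localFacet x Fv, 𝔸.IsInter 𝔸.anyHalves T ∧ T ⊆ S := Iff.rfl

theorem localFacet_le_facet (x : P) (Fv : Set V) : localFacet x Fv ≤ 𝔸.facet x Fv := le_hull _

theorem enclosure_mono {F G : Filter P} (h : F ≤ G) : 𝔸.enclosure F ≤ 𝔸.enclosure G := by
  rintro S ⟨T, hT, hi, hTS⟩
  exact ⟨T, h hT, hi, hTS⟩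

theorem IsInter.closed_to_any {T : Set P} (h : 𝔸.IsInter 𝔸.closedHalves T) :
    𝔸.IsInter 𝔸.anyHalves T := by
  obtain ⟨k, hk, rfl⟩ := h
  exact ⟨k, fun f hf => 𝔸.closedHalves_subset f (hk f hf), rfl⟩

/-- A point satisfying all the inequalities given by roots on an enclosed set belongs to it. -/
theorem IsInter.mem {T : Set P} (hT : 𝔸.IsInter 𝔸.closedHalves T) {p : P}
    (h : ∀ β ∈ 𝔸.allRoots, ∀ n : P, (∀ q ∈ T, 0 ≤ β (q -ᵥ n)) → 0 ≤ β (p -ᵥ n)) : p ∈ T := by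
  obtain ⟨k, hk, rfl⟩ := hT
  refine Set.mem_iInter₂.2 fun β hβ => ?_
  rcases hk β hβ with h1 | ⟨n, -, h1⟩
  · rw [h1]
    trivial
  · rw [h1]
    refine h β hβ n fun q hq => ?_
    have := Set.mem_iInter₂.1 hq β hβ
    rwa [h1] at this

theorem mem_localFacet {x : P} {Fv : Set V} {S : Set P} :
    S ∈ localFacet x Fv ↔ ∀ᶠ v in 𝓝[Fv] 0, v +ᵥ x ∈ S := Iff.rfl

theorem mem_addSet {F : Filter P} {E : Set V} {S : Set P} :
    S ∈ addSet F E ↔ ∃ T ∈ F, ∀ v ∈ E, ∀ p ∈ T, v +ᵥ p ∈ S := by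
  rw [addSet, mem_map, mem_prod_iff]
  constructor
  · rintro ⟨t, ht, T, hT, h⟩
    exact ⟨T, hT, fun v hv p hp => h (Set.mk_mem_prod (ht hv) hp)⟩
  · rintro ⟨T, hT, h⟩
    exact ⟨E, mem_principal_self E, T, hT, fun q hq => h _ hq.1 _ hq.2⟩

/-- The filter of the sets containing a translate of `C`. -/
def sectorGerm (C : Set V) : Filter P := ⨅ x : P, 𝓟 ((fun v => v +ᵥ x) '' C)

theorem mem_sectorGerm {γ : ι → Module.Dual ℝ V} (hne : (facetCone γ ∅).Nonempty) {S : Set P} :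
    S ∈ sectorGerm (P := P) (facetCone γ ∅) ↔ ∃ x : P, ∀ v ∈ facetCone γ ∅, v +ᵥ x ∈ S := by
  have : Nonempty P := AddTorsor.nonempty (G := V)
  obtain ⟨c, hc⟩ := hne
  rw [sectorGerm, mem_iInf_of_directed]
  · simp [Set.subset_def]
  · intro x y
    obtain ⟨N, hN, h⟩ := exists_forall_nonneg_add_mul (fun j => γ j (x -ᵥ y)) (fun j => γ j c) ∅
      hc.2
    refine ⟨N • c +ᵥ x, ?_, ?_⟩ <;> refine principal_mono.2 ?_ <;> rintro _ ⟨v, hv, rfl⟩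
    · refine ⟨v + N • c, ⟨by simp, fun j hj => ?_⟩, by simp [add_vadd]⟩
      have := mul_nonneg hN (hc.2 j hj).le
      simpa using add_pos_of_pos_of_nonneg (hv.2 j hj) this
    · refine ⟨v + (N • c + (x -ᵥ y)), ⟨by simp, fun j hj => ?_⟩, by simp [add_vadd]⟩
      have := h N le_rfl j hj
      have h2 := hv.2 j hj
      simp only [map_add, map_smul, smul_eq_mul]
      linarith

end ModelApartment

end Masure

end

noncomputable section

namespace Masure

namespace ModelApartment

variable {V : Type*} [NormedAddCommGroup V] [NormedSpace ℝ V]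
  {P : Type*} [AddTorsor V P] {ι : Type*} [Fintype ι] {𝔸 : ModelApartment V P ι}

/-! ### Minimal facets -/

theorem allRoots_apply_eq_zero {β : Module.Dual ℝ V} (hβ : β ∈ 𝔸.allRoots) {v : V}
    (hv : v ∈ 𝔸.stdFacet Set.univ) : β v = 0 := by
  have h0 : ∀ j, 𝔸.simple 1 j v = 0 := fun j => hv.1 j trivial
  obtain ⟨c, -, h | h⟩ := 𝔸.allRoots_sign (one_mem _) hβ
  · simp [h, h0]
  · rw [← neg_eq_zero, ← LinearMap.neg_apply, h]
    simp [h0]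

theorem isVFacet_stdFacet (J : Set ι) : 𝔸.IsVFacet (𝔸.stdFacet J) :=
  ⟨J, Or.inl ⟨1, one_mem _, by simp⟩⟩

theorem pure_le_facet_stdFacet_univ (x : P) : pure x ≤ 𝔸.facet x (𝔸.stdFacet Set.univ) := by
  refine le_trans ?_ (localFacet_le_facet _ _)
  intro S hS
  have h0 : (0 : V) ∈ 𝔸.stdFacet Set.univ := ⟨by simp, by simp⟩
  simpa using mem_of_mem_nhdsWithin h0 (mem_localFacet.1 hS)

/-- All roots vanish on the minimal vectorial facet, so an enclosed set containing `x` contains `x`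
translated by that facet. -/
theorem facet_stdFacet_univ_le (x : P) :
    𝔸.facet x (𝔸.stdFacet Set.univ) ≤ 𝔸.enclosure (pure x) := by
  rintro S ⟨T, hT, hi, hTS⟩
  refine ⟨T, ?_, hi.closed_to_any, hTS⟩
  refine mem_localFacet.2 (eventually_mem_nhdsWithin.mono fun v hv => hi.mem fun β hβ n h => ?_)
  rw [vadd_vsub_assoc, map_add, allRoots_apply_eq_zero hβ hv, zero_add]
  exact h x hT

/-! ### Sector germs are germs of splayed chimneys -/

theorem isInter_of_simple (𝔸 : ModelApartment V P ι) {w : V ≃ₗ[ℝ] V} (hw : w ∈ 𝔸.weylGroup)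
    (m : ι → P) (hm : ∀ j, hyperplane (𝔸.simple w j) (m j) ∈ 𝔸.walls) :
    𝔸.IsInter 𝔸.closedHalves (⋂ j, closedHalf (𝔸.simple w j) (m j)) := by
  classical
  -- The intersection has to be indexed by roots: injectivity recovers `j` from the root, and all
  -- the other roots receive the whole space.
  have hinj : Function.Injective (𝔸.simple w) := (𝔸.simple_linearIndependent w).injective
  refine ⟨fun f => if h : ∃ j, 𝔸.simple w j = f then closedHalf f (m h.choose) else Set.univ,
    fun f _ => ?_, ?_⟩
  · dsimp only
    split_ifs with h
    · have h1 := h.choose_spec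
      refine Or.inr ⟨m h.choose, Or.inl ⟨h1 ▸ 𝔸.simple_mem_realRoots hw _, ?_⟩, rfl⟩
      have h2 := hm h.choose
      rwa [h1] at h2
    · exact Or.inl rfl
  · have key : ∀ j, ∀ h : ∃ k, 𝔸.simple w k = 𝔸.simple w j, h.choose = j :=
      fun j h => hinj h.choose_spec
    ext p
    simp only [Set.mem_iInter]
    constructor
    · intro hp f _
      split_ifs with h
      · obtain ⟨j, rfl⟩ := h
        rw [key j]
        exact hp j
      · trivial
    · intro hp j
      have h1 : ∃ k, 𝔸.simple w k = 𝔸.simple w j := ⟨j, rfl⟩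
      have := hp _ (Or.inl (𝔸.simple_mem_realRoots hw j))
      rwa [dif_pos h1, key j] at this

section FiniteDimensional

variable [FiniteDimensional ℝ V]

theorem neBot_localFacet {Fv : Set V} (h : (0 : V) ∈ closure Fv) (x : P) :
    (localFacet x Fv).NeBot := by
  have := mem_closure_iff_nhdsWithin_neBot.1 h
  exact Filter.map_neBot

theorem simple_cone_nonempty (𝔸 : ModelApartment V P ι) (w : V ≃ₗ[ℝ] V) (J : Set ι) :
    (facetCone (𝔸.simple w) J).Nonempty :=
  facetCone_nonempty (𝔸.simple_linearIndependent w) J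

/-- The sector at `y` contains an intersection of half-apartments bounded by walls beyond `y`, and
the base lies in one bounded by walls behind `x`; a long translation inside the chamber carries the
second into the first. Conversely, each shortening of the chimney contains a translate of the
chamber. -/
theorem chimneyGerm_chamber {w : V ≃ₗ[ℝ] V} (hw : w ∈ 𝔸.weylGroup) (x : P) :
    𝔸.chimneyGerm (𝔸.facet x (facetCone (𝔸.simple w) ∅)) (facetCone (𝔸.simple w) ∅) =
      sectorGerm (facetCone (𝔸.simple w) ∅) := by
  obtain ⟨c, hc⟩ := 𝔸.simple_cone_nonempty w ∅
  refine le_antisymm (le_iInf fun y => le_principal_iff.2 ?_)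
    (le_iInf₂ fun ξ hξ S ⟨T, hT, _, hTS⟩ => ?_)
  · choose m hm hmy using fun j => (𝔸.exists_wall_gt hw j y 0).1
    choose n hn hnx using fun j => (𝔸.exists_wall_gt hw j x 0).2
    obtain ⟨N, hN, h⟩ := exists_forall_nonneg_add_mul
      (fun j => 𝔸.simple w j (n j -ᵥ m j)) (fun j => 𝔸.simple w j c) ∅ hc.2
    -- `N` may be `0`, whereas the shift must lie in the open cone.
    have hξ : (N + 1) • c ∈ facetCone (𝔸.simple w) ∅ :=
      smul_mem_facetCone hc (by linarith)
    refine mem_iInf_of_mem _ (mem_iInf_of_mem (subset_closure hξ)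
      ⟨_, ?_, isInter_of_simple 𝔸 hw m hm, ?_⟩)
    · refine mem_addSet.2 ⟨_, image_mem_map (m := fun p => (N + 1) • c +ᵥ p)
        (mem_facet.2 ⟨⋂ j, closedHalf (𝔸.simple w j) (n j), ?_,
        (isInter_of_simple 𝔸 hw n hn).closed_to_any, subset_rfl⟩), ?_⟩
      · refine mem_localFacet.2 (eventually_mem_nhdsWithin.mono fun v hv => ?_)
        refine Set.mem_iInter.2 fun j => ?_
        change 0 ≤ 𝔸.simple w j ((v +ᵥ x) -ᵥ n j)
        have h1 := hnx j
        rw [← neg_vsub_eq_vsub_rev, map_neg] at h1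
        rw [vadd_vsub_assoc, map_add]
        linarith [hv.2 j (by simp)]
      · rintro v hv _ ⟨p, hp, rfl⟩
        refine Set.mem_iInter.2 fun j => ?_
        have h1 : 0 ≤ 𝔸.simple w j (p -ᵥ n j) := Set.mem_iInter.1 hp j
        have h2 := h (N + 1) (by linarith) j (by simp)
        change 0 ≤ 𝔸.simple w j ((v +ᵥ ((N + 1) • c +ᵥ p)) -ᵥ m j)
        rw [vadd_vsub_assoc, vadd_vsub_assoc, ← vsub_add_vsub_cancel p (n j) (m j)]
        simp only [map_add, map_smul, smul_eq_mul]
        linarith [hv.2 j (by simp)]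
    · intro p hp
      refine ⟨p -ᵥ y, ⟨by simp, fun j _ => ?_⟩, vsub_vadd _ _⟩
      have h1 : 0 ≤ 𝔸.simple w j (p -ᵥ m j) := Set.mem_iInter.1 hp j
      rw [← vsub_add_vsub_cancel p (m j) y, map_add]
      linarith [hmy j]
  · obtain ⟨U, hU, hUT⟩ := mem_addSet.1 hT
    have := neBot_localFacet (zero_mem_closure_facetCone ⟨c, hc⟩) x
    have : (𝔸.facet x (facetCone (𝔸.simple w) ∅)).NeBot :=
      neBot_of_le (localFacet_le_facet x _)
    obtain ⟨p, hp⟩ := nonempty_of_mem hU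
    refine mem_iInf_of_mem p (mem_principal.2 ?_)
    rintro _ ⟨v, hv, rfl⟩
    exact hTS (hUT v hv p hp)

/-- A filter that detects the affine automorphisms of the model. -/
def IsRigid (G : Filter P) : Prop := ∀ u : P ≃ᵃ[ℝ] P, (∀ᶠ p in G, u p = p) → u = 1

theorem isRigid_sectorGerm (w : V ≃ₗ[ℝ] V) :
    IsRigid (sectorGerm (P := P) (facetCone (𝔸.simple w) ∅)) := by
  intro u hu
  obtain ⟨x, hx⟩ := (mem_sectorGerm (𝔸.simple_cone_nonempty w ∅)).1 hu
  exact affineEquiv_eq_one_of_isOpen (isOpen_facetCone_empty _) (𝔸.simple_cone_nonempty w ∅) hx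

theorem isSplayed_sectorGerm {w : V ≃ₗ[ℝ] V} (hw : w ∈ 𝔸.weylGroup) :
    𝔸.IsSplayedChimneyGerm (sectorGerm (facetCone (𝔸.simple w) ∅)) := by
  obtain ⟨x⟩ : Nonempty P := AddTorsor.nonempty (G := V)
  exact ⟨x, _, _, ⟨∅, 𝔸.isFacetOfType_facetCone hw ∅⟩,
    ⟨∅, 𝔸.finite_parabolic_empty, 𝔸.isFacetOfType_facetCone hw ∅⟩, (chimneyGerm_chamber hw x).symm⟩

/-- An enclosed set in the germ of a sector is stable by the closed cone of the sector. -/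
theorem IsInter.mem_of_mem_sectorGerm {w : V ≃ₗ[ℝ] V} {T : Set P}
    (hT : 𝔸.IsInter 𝔸.closedHalves T) (hTG : T ∈ sectorGerm (facetCone (𝔸.simple w) ∅))
    {p q : P} (hp : p ∈ T) (hpq : ∀ j, 0 ≤ 𝔸.simple w j (q -ᵥ p)) : q ∈ T := by
  obtain ⟨x, hx⟩ := (mem_sectorGerm (𝔸.simple_cone_nonempty w ∅)).1 hTG
  obtain ⟨c, hc⟩ := 𝔸.simple_cone_nonempty w ∅
  refine hT.mem fun β _ n h => ?_
  -- A form bounded below on a sector is nonnegative on its direction: otherwise the chosen multiple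
  -- of `v` brings it to at most `-1`.
  have hnonneg : ∀ v ∈ facetCone (𝔸.simple w) ∅, 0 ≤ β v := by
    intro v hv
    by_contra! hneg
    have h1 := h _ (hx _ (smul_mem_facetCone hv
      (t := (|β (x -ᵥ n)| + 1) / (-β v)) (div_pos (by positivity) (by linarith))))
    rw [vadd_vsub_assoc, map_add, map_smul, smul_eq_mul, div_neg, neg_mul,
      div_mul_cancel₀ _ hneg.ne] at h1
    linarith [le_abs_self (β (x -ᵥ n))]
  have h2 : ∀ t : ℝ, 0 < t → 0 ≤ β (q -ᵥ p) + t * β c := by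
    intro t ht
    have := hnonneg ((q -ᵥ p) + t • c) ⟨by simp, fun j hj => ?_⟩
    · simpa using this
    · simpa using add_pos_of_nonneg_of_pos (hpq j) (mul_pos ht (hc.2 j hj))
  have h3 : 0 ≤ β (q -ᵥ p) := by
    by_contra! hneg
    have hc0 := hnonneg c hc
    -- This factor is small enough that its product with `β c` compensates at most half of the
    -- negative number `β (q - p)`.
    have h4 := h2 (-β (q -ᵥ p) / (2 * (β c + 1))) (div_pos (by linarith) (by linarith))
    have h5 : -β (q -ᵥ p) / (2 * (β c + 1)) * β c ≤ -β (q -ᵥ p) / 2 := by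
      rw [div_mul_eq_mul_div, div_le_div_iff₀ (by linarith) (by norm_num)]
      nlinarith
    linarith
  rw [← vsub_add_vsub_cancel q p n, map_add]
  exact add_nonneg h3 (h p hp)

/-! ### Chimneys along a panel -/

/-- The shortenings form a directed family, since shifts in the closed cone add up, so membership in
the infimum is decided at a single `ξ`. -/
theorem mem_chimneyGerm {γ : ι → Module.Dual ℝ V} {J : Set ι} (hne : (facetCone γ J).Nonempty)
    {F : Filter P} {S : Set P} : S ∈ 𝔸.chimneyGerm F (facetCone γ J) ↔
      ∃ ξ ∈ closure (facetCone γ J), ∃ T, 𝔸.IsInter 𝔸.closedHalves T ∧ T ⊆ S ∧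
        ∃ U ∈ F, ∀ v ∈ facetCone γ J, ∀ p ∈ U, v +ᵥ (ξ +ᵥ p) ∈ T := by
  have hdir : ∀ ξ ∈ closure (facetCone γ J), ∀ η ∈ closure (facetCone γ J),
      𝔸.enclosure (addSet (map (fun p => (η + ξ) +ᵥ p) F) (facetCone γ J)) ≤
        𝔸.enclosure (addSet (map (fun p => ξ +ᵥ p) F) (facetCone γ J)) := by
    intro ξ _ η hη
    refine enclosure_mono fun S hS => ?_
    obtain ⟨U, hU, h⟩ := mem_addSet.1 hS
    refine mem_addSet.2 ⟨_, image_mem_map hU, ?_⟩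
    rintro v hv _ ⟨p, hp, rfl⟩
    have := h _ (closure_add_mem_facetCone hη hv) _ hp
    have he : (η + v) +ᵥ (ξ +ᵥ p) = v +ᵥ ((η + ξ) +ᵥ p) := by
      simp only [← add_vadd]
      congr 1
      abel
    rwa [he] at this
  rw [chimneyGerm, mem_biInf_of_directed]
  · refine exists_congr fun ξ => and_congr_right fun hξ => ?_
    rw [mem_enclosure]
    constructor
    · rintro ⟨T, hT, hi, hTS⟩
      obtain ⟨U, hU, h⟩ := mem_addSet.1 hT
      exact ⟨T, hi, hTS, _, hU, fun v hv p hp => h v hv _ hp⟩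
    · rintro ⟨T, hi, hTS, U, hU, h⟩
      refine ⟨T, mem_addSet.2 ⟨_, image_mem_map hU, ?_⟩, hi, hTS⟩
      rintro v hv _ ⟨p, hp, rfl⟩
      exact h v hv p hp
  · intro ξ hξ η hη
    refine ⟨η + ξ, add_mem_closure_facetCone hη hξ, hdir ξ hξ η hη, ?_⟩
    have := hdir η hη ξ hξ
    rwa [add_comm] at this
  · obtain ⟨v, hv⟩ := hne
    exact ⟨v, subset_closure hv⟩

variable {γ : ι → Module.Dual ℝ V} {J : Set ι} {w : V ≃ₗ[ℝ] V}

theorem eventually_of_mem_facet {x : P} {Fv : Set V} {U : Set P} (hU : U ∈ 𝔸.facet x Fv) :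
    ∃ O : Set V, IsOpen O ∧ (0 : V) ∈ O ∧ ∀ v ∈ O, v ∈ Fv → v +ᵥ x ∈ U := by
  have h := mem_localFacet.1 (localFacet_le_facet x Fv hU)
  rw [eventually_nhdsWithin_iff, eventually_nhds_iff] at h
  obtain ⟨O, h1, h2, h3⟩ := h
  exact ⟨O, h2, h3, h1⟩

theorem isOpen_nonempty_inter_chamber (𝔸 : ModelApartment V P ι) (w : V ≃ₗ[ℝ] V) {O : Set V}
    (hO : IsOpen O) (h0 : (0 : V) ∈ O) :
    IsOpen (O ∩ facetCone (𝔸.simple w) ∅) ∧ (O ∩ facetCone (𝔸.simple w) ∅).Nonempty :=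
  ⟨hO.inter (isOpen_facetCone_empty _), mem_closure_iff.1
    (zero_mem_closure_facetCone (𝔸.simple_cone_nonempty w ∅)) O hO h0⟩

/-- The base contains pieces of an open chamber at `x`, so every member of the germ contains a
nonempty open set, and an affine automorphism is determined by its values there. -/
theorem isRigid_chimneyGerm (hne : (facetCone γ J).Nonempty) (x : P) :
    IsRigid (𝔸.chimneyGerm (𝔸.facet x (facetCone (𝔸.simple w) ∅)) (facetCone γ J)) := by
  intro u hu
  obtain ⟨ξ, -, T, -, hTS, U, hU, h⟩ := (mem_chimneyGerm hne).1 hu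
  obtain ⟨O, hO, h0, hOU⟩ := eventually_of_mem_facet hU
  obtain ⟨v, hv⟩ := hne
  obtain ⟨h1, h2⟩ := isOpen_nonempty_inter_chamber 𝔸 w hO h0
  refine affineEquiv_eq_one_of_isOpen (x := v +ᵥ (ξ +ᵥ x)) h1 h2 fun y hy => ?_
  have := hTS (h v hv _ (hOU y hy.1 hy.2))
  have he : v +ᵥ (ξ +ᵥ (y +ᵥ x)) = y +ᵥ (v +ᵥ (ξ +ᵥ x)) := by
    simp only [← add_vadd]
    congr 1
    abel
  rwa [he] at this

theorem isSolid_chimney (hne : (facetCone γ J).Nonempty) (x : P) :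
    𝔸.IsSolid (𝔸.chimney (𝔸.facet x (facetCone (𝔸.simple w) ∅)) (facetCone γ J)) := by
  have htop : support (𝔸.chimney (𝔸.facet x (facetCone (𝔸.simple w) ∅)) (facetCone γ J)) = ⊤ := by
    refine sInf_eq_top.2 fun E hE => ?_
    obtain ⟨U, hU, h⟩ := mem_addSet.1 (le_enclosure _ hE)
    obtain ⟨O, hO, h0, hOU⟩ := eventually_of_mem_facet hU
    obtain ⟨v, hv⟩ := hne
    obtain ⟨h1, h2⟩ := isOpen_nonempty_inter_chamber 𝔸 w hO h0
    refine affineSubspace_eq_top_of_isOpen (x := v +ᵥ x) h1 h2 fun y hy => ?_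
    have := h v hv _ (hOU y hy.1 hy.2)
    rwa [vadd_comm] at this
  refine (Set.finite_singleton (1 : V ≃ₗ[ℝ] V)).subset ?_
  rintro g ⟨-, hg⟩
  rw [htop, AffineSubspace.direction_top] at hg
  exact LinearEquiv.ext fun v => hg v trivial

/-- The germ of a chimney with base a chamber facet contains initial pieces of the half-lines
issued from its apex in the direction of the chamber. -/
theorem exists_of_mem_chimneyGerm (hne : (facetCone γ J).Nonempty) {x : P} {S : Set P}
    (hS : S ∈ 𝔸.chimneyGerm (𝔸.facet x (facetCone (𝔸.simple w) ∅)) (facetCone γ J))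
    {c : V} (hc : c ∈ facetCone (𝔸.simple w) ∅) :
    ∃ ξ ∈ closure (facetCone γ J), ∃ ε : ℝ, 0 < ε ∧ ∀ s : ℝ, 0 ≤ s → s ≤ ε →
      ∀ v ∈ facetCone γ J, v +ᵥ (s • c +ᵥ (ξ +ᵥ x)) ∈ S := by
  obtain ⟨ξ, hξ, T, hT, hTS, U, hU, h⟩ := (mem_chimneyGerm hne).1 hS
  obtain ⟨O, hO, h0, hOU⟩ := eventually_of_mem_facet hU
  have h1 := (tendsto_smul_zero c).eventually_mem (hO.mem_nhds h0)
  obtain ⟨ε, hε, hεO⟩ := mem_nhdsGT_iff_exists_Ioc_subset.1 h1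
  have hpos : ∀ s, 0 < s → s ≤ ε → ∀ v ∈ facetCone γ J, v +ᵥ (s • c +ᵥ (ξ +ᵥ x)) ∈ T := by
    intro s hs hsε v hv
    have := h v hv _ (hOU (s • c) (hεO ⟨hs, hsε⟩) (smul_mem_facetCone hc hs))
    rwa [vadd_comm ξ] at this
  refine ⟨ξ, hξ, ε, hε, fun s hs hsε v hv => hTS ?_⟩
  rcases hs.lt_or_eq with hs | rfl
  · exact hpos s hs hsε v hv
  -- The level `s = 0` is reached as a limit, enclosed sets being cut out by non-strict
  -- inequalities. The induction on levels uses this endpoint.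
  refine hT.mem fun β _ n hβ => ?_
  have h2 : ∀ t, 0 < t → t ≤ ε → 0 ≤ t * β c + β ((v +ᵥ (ξ +ᵥ x)) -ᵥ n) := by
    intro t ht htε
    have := hβ _ (hpos t ht htε v hv)
    rwa [vadd_comm, vadd_vsub_assoc, map_add, map_smul] at this
  rw [zero_smul, zero_vadd]
  refine ge_of_tendsto (x := 𝓝[>] (0 : ℝ))
    (f := fun t => t * β c + β ((v +ᵥ (ξ +ᵥ x)) -ᵥ n)) ?_ ?_
  · have : Tendsto (fun t : ℝ => t * β c + β ((v +ᵥ (ξ +ᵥ x)) -ᵥ n)) (𝓝 0)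
        (𝓝 (0 * β c + β ((v +ᵥ (ξ +ᵥ x)) -ᵥ n))) :=
      Continuous.tendsto (by fun_prop) 0
    rw [zero_mul, zero_add] at this
    exact this.mono_left nhdsWithin_le_nhds
  · filter_upwards [Ioc_mem_nhdsGT hε] with t ht
    exact h2 t ht.1 ht.2

/-- An enclosed set containing a point `m` and a translate of the opposite of the panel of type
`{i}` of a chamber `C` contains the points of `m - C` above this translate. -/
theorem IsInter.mem_of_panel {T : Set P} (hT : 𝔸.IsInter 𝔸.closedHalves T)
    (hw : w ∈ 𝔸.weylGroup) {i : ι} {y m p : P}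
    (hy : ∀ v ∈ facetCone (-𝔸.simple w) {i}, v +ᵥ y ∈ T) (hm : m ∈ T)
    (hpm : ∀ j, 𝔸.simple w j (p -ᵥ m) ≤ 0) (hpy : 0 ≤ 𝔸.simple w i (p -ᵥ y)) : p ∈ T := by
  refine hT.mem fun β hβ n h => ?_
  obtain ⟨v, hv⟩ := 𝔸.simple_cone_nonempty w {i}
  have hneg : ∀ t : ℝ, 0 < t → -(t • v) ∈ facetCone (-𝔸.simple w) {i} := by
    intro t ht
    simpa [facetCone] using smul_mem_facetCone hv ht
  -- A positive `β` bounded below along the opposite panel must be a multiple of `w αᵢ`, so the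
  -- level of `p` above `y` decides. A negative `β` is nonnegative at `p - m`, so the point `m`
  -- decides.
  obtain ⟨c, hc, hβc | hβc⟩ := 𝔸.allRoots_sign hw hβ
  · have hβv : β v ≤ 0 := by
      by_contra! hpos
      have h1 := h _ (hy _ (hneg ((|β (y -ᵥ n)| + 1) / β v) (by positivity)))
      rw [vadd_vsub_assoc, map_add, map_neg, map_smul, smul_eq_mul,
        div_mul_cancel₀ _ hpos.ne'] at h1
      linarith [le_abs_self (β (y -ᵥ n))]
    have hβi : β = c i • 𝔸.simple w i := by
      rw [hβc]
      exact RootBase.eq_smul_of_apply_nonpos hc hv (hβc ▸ hβv)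
    have h1 := h _ (hy _ (hneg 1 one_pos))
    rw [← vsub_add_vsub_cancel p y n, map_add]
    rw [vadd_vsub_assoc, map_add] at h1
    have h2 : β (-((1 : ℝ) • v)) = 0 := by
      rw [hβi]
      simp [hv.1 i rfl]
    have h3 : 0 ≤ β (p -ᵥ y) := by
      rw [hβi]
      exact mul_nonneg (hc i) hpy
    linarith
  · have h1 : 0 ≤ β (p -ᵥ m) := by
      rw [← neg_nonpos, ← LinearMap.neg_apply, hβc, LinearMap.sum_apply]
      exact Finset.sum_nonpos fun j _ => mul_nonpos_of_nonneg_of_nonpos (hc j) (hpm j)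
    rw [← vsub_add_vsub_cancel p m n, map_add]
    exact add_nonneg h1 (h m hm)

end FiniteDimensional

end ModelApartment

end Masure

end

noncomputable section

namespace Masure

/-! ### Charts of the apartments of a hovel -/

namespace ApartmentSystem

variable {V : Type*} [NormedAddCommGroup V] [NormedSpace ℝ V]
  {P : Type*} [AddTorsor V P] {ι : Type*} [Fintype ι] {𝔸 : ModelApartment V P ι}
  {X : Type*} {S : ApartmentSystem 𝔸 X} {A A' B : Set X} {f g : P → X}

theorem isom_injective (hA : A ∈ S.apartments) (hf : f ∈ S.isom A) : Function.Injective f :=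
  Set.injOn_univ.1 (S.isom_bijOn A hA f hf).injOn

theorem isom_mem (hA : A ∈ S.apartments) (hf : f ∈ S.isom A) (p : P) : f p ∈ A :=
  (S.isom_bijOn A hA f hf).mapsTo trivial

theorem exists_isom_eq (hA : A ∈ S.apartments) (hf : f ∈ S.isom A) {x : X} (hx : x ∈ A) :
    ∃ p, f p = x := by
  obtain ⟨p, -, hp⟩ := (S.isom_bijOn A hA f hf).surjOn hx
  exact ⟨p, hp⟩

theorem mem_map_isom (hA : A ∈ S.apartments) (hf : f ∈ S.isom A) (G : Filter P) : A ∈ map f G :=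
  mem_map.2 (univ_mem' fun p => isom_mem hA hf p)

theorem IsIso.comp_mem (hA : A ∈ S.apartments) (hA' : A' ∈ S.apartments) {φ : X → X}
    (hφ : S.IsIso A A' φ) (hf : f ∈ S.isom A) : φ ∘ f ∈ S.isom A' := by
  obtain ⟨g, hg, hφg⟩ := hφ
  obtain ⟨u, hu, rfl⟩ := (S.isom_iff A hA g hg f).1 hf
  exact (S.isom_iff A' hA' _ hφg _).2 ⟨u, hu, rfl⟩

/-- (MA3) and (MA4) concern facets rather than points. The minimal facet at `x` serves as a
substitute: by (MA2) for the point `x`, every apartment through `x` contains it. -/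
theorem IsAffineHovel.exists_pointFacet (hS : S.IsAffineHovel) (x : X) :
    ∃ F : Filter X, S.Is 𝔸.IsFacet F ∧ pure x ≤ F ∧ ∀ A ∈ S.apartments, x ∈ A → A ∈ F := by
  obtain ⟨A, hA, hx⟩ : x ∈ ⋃₀ S.apartments := S.cover ▸ Set.mem_univ x
  obtain ⟨f, hf⟩ := S.isom_nonempty A hA
  obtain ⟨p, rfl⟩ := exists_isom_eq hA hf hx
  refine ⟨map f (𝔸.facet p (𝔸.stdFacet Set.univ)),
    ⟨A, hA, f, hf, _, ⟨p, _, ModelApartment.isVFacet_stdFacet _, rfl⟩, rfl⟩, ?_, fun A' hA' hp => ?_⟩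
  · rw [← map_pure]
    exact map_mono (ModelApartment.pure_le_facet_stdFacet_univ p)
  · have h := (hS.ma2 A hA A' hA' (pure (f p))
      (Or.inl ⟨f, hf, pure p, ⟨p, rfl⟩, (map_pure f p).symm⟩) hp f hf).1
    rw [← map_pure, comap_map (isom_injective hA hf)] at h
    exact map_mono (ModelApartment.facet_stdFacet_univ_le p)
      (mem_of_superset h Set.inter_subset_right)

/-- The consequence of (MA4) for a splayed chimney germ and a point. -/
theorem IsAffineHovel.exists_shared (hS : S.IsAffineHovel) (hA : A ∈ S.apartments)
    (hA' : A' ∈ S.apartments) (hf : f ∈ S.isom A) {G : Filter P}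
    (hG : 𝔸.IsSplayedChimneyGerm G) (hA'G : A' ∈ map f G) {p : P} (hp : f p ∈ A') :
    (∃ T ∈ G, p ∈ T ∧ 𝔸.IsInter 𝔸.closedHalves T ∧ ∀ q ∈ T, f q ∈ A') ∧
      ∃ f' ∈ S.isom A', (∀ᶠ q in G, f' q = f q) ∧ f' p = f p := by
  obtain ⟨F, hF, hpF, hFA⟩ := hS.exists_pointFacet (f p)
  obtain ⟨h1, φ, hφ, h2⟩ := hS.ma4 (map f G) F ⟨A, hA, f, hf, G, hG, rfl⟩ (Or.inl hF) A hA A' hA'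
    (mem_map_isom hA hf G) (hFA A hA (isom_mem hA hf p)) hA'G (hFA A' hA' hp) f hf
  have hle : G ≤ comap f (map f G ⊔ F) := le_comap_map.trans (comap_mono le_sup_left)
  have hle' : pure p ≤ comap f (map f G ⊔ F) := by
    rw [← map_le_iff_le_comap, map_pure]
    exact hpF.trans le_sup_right
  constructor
  · obtain ⟨T, hT, hi, hTS⟩ := ModelApartment.mem_enclosure.1 (mem_map.1 h1)
    exact ⟨T, hle hT, hle' hT, hi, fun q hq => (hTS hq).2⟩
  · have h3 := eventually_map.1 h2
    exact ⟨φ ∘ f, hφ.comp_mem hA hA' hf, (hle.trans (ModelApartment.le_enclosure _)) h3,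
      (hle'.trans (ModelApartment.le_enclosure _)) h3⟩

/-- Two apartments sharing a rigid splayed chimney germ have charts that agree on the whole
intersection. -/
theorem IsAffineHovel.exists_chart (hS : S.IsAffineHovel) (hA : A ∈ S.apartments)
    (hA' : A' ∈ S.apartments) (hf : f ∈ S.isom A) {G : Filter P}
    (hG : 𝔸.IsSplayedChimneyGerm G) (hrig : ModelApartment.IsRigid G) (hA'G : A' ∈ map f G) :
    ∃ f' ∈ S.isom A', ∀ p, f p ∈ A' → f' p = f p := by
  by_cases hne : ∃ p, f p ∈ A'
  · obtain ⟨p₀, hp₀⟩ := hne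
    obtain ⟨-, f', hf', h1, -⟩ := hS.exists_shared hA hA' hf hG hA'G hp₀
    -- For each `p`, (MA4) gives a chart that agrees with `f` on the germ and at `p`. All these
    -- charts agree on the germ, so rigidity identifies them with `f'`.
    refine ⟨f', hf', fun p hp => ?_⟩
    obtain ⟨-, f'', hf'', h2, h3⟩ := hS.exists_shared hA hA' hf hG hA'G hp
    obtain ⟨u, -, rfl⟩ := (S.isom_iff A' hA' f' hf' f'').1 hf''
    have hu : u = 1 := hrig u <| (h1.and h2).mono fun q hq =>
      isom_injective hA' hf' (hq.2.trans hq.1.symm)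
    rw [← h3, hu]
    rfl
  · obtain ⟨f', hf'⟩ := S.isom_nonempty A' hA'
    exact ⟨f', hf', fun p hp => (hne ⟨p, hp⟩).elim⟩

theorem map_eq_of_agree {G : Filter P} (hB : B ∈ map f G) (h : ∀ p, f p ∈ B → g p = f p) :
    map f G = map g G := by
  refine Filter.map_congr ?_
  filter_upwards [mem_map.1 hB] with p hp
  exact (h p hp).symm

variable [FiniteDimensional ℝ V] {w : V ≃ₗ[ℝ] V}

/-- Charts of apartments containing a common sector germ agree with a given one. -/
theorem IsAffineHovel.exists_sector_chart (hS : S.IsAffineHovel) (hA : A ∈ S.apartments)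
    (hA' : A' ∈ S.apartments) (hf : f ∈ S.isom A) (hw : w ∈ 𝔸.weylGroup)
    (hA'G : A' ∈ map f (ModelApartment.sectorGerm (facetCone (𝔸.simple w) ∅))) :
    ∃ f' ∈ S.isom A', (∀ p, f p ∈ A' → f' p = f p) ∧
      map f (ModelApartment.sectorGerm (facetCone (𝔸.simple w) ∅)) =
        map f' (ModelApartment.sectorGerm (facetCone (𝔸.simple w) ∅)) := by
  obtain ⟨f', hf', h⟩ := hS.exists_chart hA hA' hf (ModelApartment.isSplayed_sectorGerm hw)
    (ModelApartment.isRigid_sectorGerm w) hA'G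
  exact ⟨f', hf', h, map_eq_of_agree hA'G h⟩

/-! ### Retractions centred at a sector germ. -/

theorem isIso_comp_invFun [Nonempty P] (hB : B ∈ S.apartments) (hf : f ∈ S.isom A)
    (hg : g ∈ S.isom B) : S.IsIso B A (f ∘ Function.invFun g) := by
  refine ⟨g, hg, ?_⟩
  rwa [Function.comp_assoc, Function.invFun_comp (isom_injective hB hg), Function.comp_id]

theorem eventually_comp_invFun [Nonempty P] (hA : A ∈ S.apartments) (hB : B ∈ S.apartments)
    (hf : f ∈ S.isom A) (hg : g ∈ S.isom B) (h : ∀ p, f p ∈ B → g p = f p) {R : Filter X}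
    (hAR : A ∈ R) (hBR : B ∈ R) : ∀ᶠ y in R, (f ∘ Function.invFun g) y = y := by
  filter_upwards [hAR, hBR] with y hyA hyB
  obtain ⟨p, rfl⟩ := exists_isom_eq hA hf hyA
  have := h p hyB
  rw [Function.comp_apply, ← this, Function.leftInverse_invFun (isom_injective hB hg), this]

/-- Existence of the retraction centred at a sector germ. -/
theorem IsAffineHovel.exists_retraction (hS : S.IsAffineHovel) (hA : A ∈ S.apartments)
    (hf : f ∈ S.isom A) (hw : w ∈ 𝔸.weylGroup) :
    ∃ ρ, S.IsRetraction A (map f (ModelApartment.sectorGerm (facetCone (𝔸.simple w) ∅))) ρ := by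
  have : Nonempty P := AddTorsor.nonempty (G := V)
  set G : Filter P := ModelApartment.sectorGerm (facetCone (𝔸.simple w) ∅) with hGdef
  have key : ∀ x, ∃ B ∈ S.apartments, B ∈ map f G ∧ ∃ g ∈ S.isom B,
      (∀ p, f p ∈ B → g p = f p) ∧ map f G = map g G ∧ ∃ p, g p = x := by
    intro x
    obtain ⟨F, hF, hxF, -⟩ := hS.exists_pointFacet x
    obtain ⟨B, hB, hBG, hBF⟩ := hS.ma3 (map f G) F
      ⟨A, hA, f, hf, G, ModelApartment.isSplayed_sectorGerm hw, rfl⟩ (Or.inl hF)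
    obtain ⟨g, hg, hfg, hmap⟩ := hS.exists_sector_chart hA hB hf hw hBG
    exact ⟨B, hB, hBG, g, hg, hfg, hmap, exists_isom_eq hB hg (hxF hBF)⟩
  choose B hB hBG g hg hfg hmap p hp using key
  refine ⟨fun x => f (p x), fun x => isom_mem hA hf _, fun x hx => ?_, fun x => ?_, ?_⟩
  · obtain ⟨q, rfl⟩ := exists_isom_eq hA hf hx
    have h1 := isom_mem (hB (f q)) (hg (f q)) (p (f q))
    rw [hp] at h1
    have h2 := hfg (f q) q h1
    rw [isom_injective (hB _) (hg _) ((hp (f q)).trans h2.symm)]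
  · have hx : x ∈ B x := by
      have := isom_mem (hB x) (hg x) (p x)
      rwa [hp] at this
    refine ⟨B x, hB x, hx, hBG x, _,
      isIso_comp_invFun (hB x) hf (hg x), ?_⟩
    exact eventually_comp_invFun hA (hB x) hf (hg x) (hfg x) (mem_map_isom hA hf G) (hBG x)
  · intro x B' hB' hx hB'G φ hφ hφG
    have hB'G' := hB'G
    rw [hmap x] at hB'G'
    obtain ⟨g', hg', hgg', -⟩ := hS.exists_sector_chart (hB x) hB' (hg x) hw hB'G'
    obtain ⟨u, -, hu⟩ := (S.isom_iff A hA f hf _).1 (hφ.comp_mem hB' hA hg')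
    have hu1 : u = 1 := by
      refine ModelApartment.isRigid_sectorGerm (𝔸 := 𝔸) w u ?_
      filter_upwards [mem_map.1 (hBG x), mem_map.1 hB'G, eventually_map.1 hφG] with q h1 h2 h3
      have h4 := hfg x q h1
      have h5 := hgg' q (h4 ▸ h2)
      have h6 := congrFun hu q
      simp only [Function.comp_apply] at h6
      rw [h5, h4, h3] at h6
      exact (isom_injective hA hf h6).symm
    have h1 := hgg' (p x) ((hp x).symm ▸ hx)
    have h2 := congrFun hu (p x)
    simp only [Function.comp_apply, h1, hp, hu1] at h2
    exact h2.symm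

end ApartmentSystem

end Masure

end

noncomputable section

namespace Masure

/-! ### Folding along a wall -/

/-- Let `t₀` be the infimum of the levels down to which `E` holds throughout. Then `hdown` gives `E
t₀` from a level just above, and `hup` passes strictly below `t₀`, a contradiction. -/
theorem forall_nonpos_of_steps {E : ℝ → Prop} (h0 : E 0)
    (hdown : ∀ t < 0, ∃ ε > 0, ∀ s, t ≤ s → s ≤ t + ε → s ≤ 0 → E s → E t)
    (hup : ∀ t ≤ 0, E t → ∃ ε > 0, ∀ s, t - ε ≤ s → s < t → E s) : ∀ t ≤ 0, E t := by
  by_contra! hcon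
  obtain ⟨t₁, ht₁, hnot⟩ := hcon
  -- the set of the levels above which there is no obstruction
  let A : Set ℝ := {t | t ≤ 0 ∧ ∀ s, t ≤ s → s ≤ 0 → E s}
  have hA0 : (0 : ℝ) ∈ A := ⟨le_rfl, fun s h1 h2 => by rwa [le_antisymm h2 h1]⟩
  have hbdd : BddBelow A := ⟨t₁, fun t ht => by
    by_contra! hlt
    exact hnot (ht.2 t₁ hlt.le ht₁)⟩
  set t₀ := sInf A with ht₀
  have ht₀0 : t₀ ≤ 0 := csInf_le hbdd hA0
  have habove : ∀ s, t₀ < s → s ≤ 0 → E s := by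
    intro s hs hs0
    obtain ⟨t, ht, hts⟩ := exists_lt_of_csInf_lt ⟨0, hA0⟩ hs
    exact ht.2 s hts.le hs0
  have hE : E t₀ := by
    rcases ht₀0.lt_or_eq with hlt | heq
    · obtain ⟨ε, hε, h⟩ := hdown t₀ hlt
      have h1 : t₀ < min (t₀ + ε) 0 := lt_min (by linarith) hlt
      exact h _ h1.le (min_le_left _ _) (min_le_right _ _) (habove _ h1 (min_le_right _ _))
    · rwa [heq]
  obtain ⟨ε, hε, h⟩ := hup t₀ ht₀0 hE
  have hmem : t₀ - ε ∈ A := by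
    refine ⟨by linarith, fun s hs hs0 => ?_⟩
    rcases lt_trichotomy s t₀ with h1 | h1 | h1
    · exact h s hs h1
    · rwa [h1]
    · exact habove s h1 hs0
  linarith [csInf_le hbdd hmem]

namespace ApartmentSystem

variable {V : Type*} [NormedAddCommGroup V] [NormedSpace ℝ V] [FiniteDimensional ℝ V]
  {P : Type*} [AddTorsor V P] {ι : Type*} [Fintype ι] {𝔸 : ModelApartment V P ι}
  {X : Type*} {S : ApartmentSystem 𝔸 X} {A A₁ A₂ B B' : Set X} {f g f₁ f₂ : P → X}
  {w : V ≃ₗ[ℝ] V} {i : ι} {m : P}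

theorem IsAffineHovel.mem_of_sector (hS : S.IsAffineHovel) (hB : B ∈ S.apartments)
    (hB' : B' ∈ S.apartments) (hg : g ∈ S.isom B) (hw : w ∈ 𝔸.weylGroup)
    (hB'G : B' ∈ map g (ModelApartment.sectorGerm (facetCone (𝔸.simple w) ∅))) {p q : P}
    (hp : g p ∈ B') (hpq : ∀ j, 0 ≤ 𝔸.simple w j (q -ᵥ p)) : g q ∈ B' := by
  obtain ⟨⟨T, hTG, hpT, hT, hTB⟩, -⟩ := hS.exists_shared hB hB' hg
    (ModelApartment.isSplayed_sectorGerm hw) hB'G hp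
  exact hTB q (hT.mem_of_mem_sectorGerm hTG hpT hpq)

variable (S) in
/-- Some apartment containing the sector germ of chart `f₁` and direction the chamber opposite to
`w C` along its `i`-th wall has a chart that extends `f₁` and in which `f₂` is, on the part of
`m - w C` above the level `t`, the reflection along the wall through `m`. -/
def Folded (f₁ f₂ : P → X) (w : V ≃ₗ[ℝ] V) (i : ι) (m : P) (t : ℝ) : Prop :=
  ∃ B ∈ S.apartments,
    B ∈ map f₁ (ModelApartment.sectorGerm (facetCone (𝔸.simple (w * 𝔸.refl i)) ∅)) ∧
    ∃ g ∈ S.isom B, (∀ p, f₁ p ∈ B → g p = f₁ p) ∧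
      ∀ p, (∀ j, 𝔸.simple w j (p -ᵥ m) ≤ 0) → t ≤ 𝔸.simple w i (p -ᵥ m) →
        f₂ p = g (𝔸.wallRefl w i m p)

/-- The reflection carries the cone of `w` onto that of the adjacent chamber: what lies above a
point of `A₂` in the direction `C` is read, after folding, in a sector pointing to the centre. -/
theorem simple_wallRefl (w : V ≃ₗ[ℝ] V) (i j : ι) (m p q : P) :
    𝔸.simple (w * 𝔸.refl i) j (𝔸.wallRefl w i m p -ᵥ 𝔸.wallRefl w i m q) =
      𝔸.simple w j (p -ᵥ q) := by
  rw [ModelApartment.wallRefl_apply, ModelApartment.wallRefl_apply, vadd_vsub_vadd_cancel_right,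
    ← map_sub, vsub_sub_vsub_cancel_right, 𝔸.simple_mul_refl_rootRefl]

theorem neg_smul_mem_facetCone_neg {v : V} (hv : v ∈ facetCone (𝔸.simple w) {i}) {n : ℝ}
    (hn : 0 < n) : -(n • v) ∈ facetCone (-𝔸.simple w) {i} := by
  simpa [facetCone] using smul_mem_facetCone hv hn

/-- Far along the opposite panel, a point `q` of the level `t` lies in `m - C`, where the fold is
known, and `p - q` lies in the closure of `C`. Folded into `B`, the point of `p` is in the sector
issued from that of `q` towards the centre; `B'` contains the apex and the sector germ, hence the
whole sector. -/
theorem IsAffineHovel.mem_of_folded (hS : S.IsAffineHovel) (hw : w ∈ 𝔸.weylGroup) {t : ℝ}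
    (ht : t ≤ 0) (hfold : S.Folded f₁ f₂ w i m t) (hB' : B' ∈ S.apartments)
    (hB'Q : B' ∈ map f₁ (ModelApartment.sectorGerm (facetCone (𝔸.simple (w * 𝔸.refl i)) ∅)))
    {y : P} (hyt : 𝔸.simple w i (y -ᵥ m) = t)
    (hy : ∀ v ∈ facetCone (-𝔸.simple w) {i}, f₂ (v +ᵥ y) ∈ B') {p : P}
    (hp : ∀ j, 𝔸.simple w j (p -ᵥ m) ≤ 0) (hpt : t ≤ 𝔸.simple w i (p -ᵥ m)) : f₂ p ∈ B' := by
  obtain ⟨B, hB, hBQ, g, hg, hgf, hrefl⟩ := hfold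
  rw [map_eq_of_agree hBQ hgf] at hB'Q
  obtain ⟨v, hv⟩ := 𝔸.simple_cone_nonempty w {i}
  obtain ⟨N, hN, h1⟩ := exists_forall_nonneg_add_mul (fun j => -𝔸.simple w j (y -ᵥ m))
    (fun j => 𝔸.simple w j v) {i} hv.2
  obtain ⟨N', -, h2⟩ := exists_forall_nonneg_add_mul (fun j => 𝔸.simple w j (p -ᵥ y))
    (fun j => 𝔸.simple w j v) {i} hv.2
  have hv0 : 𝔸.simple w i v = 0 := hv.1 i rfl
  set n := max N N' + 1 with hn
  have hnN : N ≤ n := by linarith [le_max_left N N']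
  have hnN' : N' ≤ n := by linarith [le_max_right N N']
  have hn0 : 0 < n := by linarith [le_max_left N N']
  have hq := hy _ (neg_smul_mem_facetCone_neg hv hn0)
  have hlevel : 𝔸.simple w i (p -ᵥ m) = 𝔸.simple w i (p -ᵥ y) + t := by
    rw [← vsub_add_vsub_cancel p y m, map_add, hyt]
  rw [hrefl (-(n • v) +ᵥ y)] at hq
  · rw [hrefl p hp hpt]
    refine hS.mem_of_sector hB hB' hg (mul_mem hw (𝔸.refl_mem i)) hB'Q hq fun j => ?_
    rw [simple_wallRefl, vsub_vadd_eq_vsub_sub, map_sub, map_neg, map_smul, smul_eq_mul]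
    by_cases hj : j = i
    · rw [hj, hv0]
      linarith
    · linarith [h2 n hnN' j hj]
  · intro j
    rw [vadd_vsub_assoc, map_add, map_neg, map_smul, smul_eq_mul]
    by_cases hj : j = i
    · rw [hj, hv0]
      linarith
    · linarith [h1 n hnN j hj]
  · rw [vadd_vsub_assoc, map_add, map_neg, map_smul, smul_eq_mul, hv0]
    linarith

/-- The apartment `B'` depends only on `x` and the chamber of `w'`, so the fold at one nearby level
on the side of `c` propagates to others on the same side. A chamber above the wall direction serves
to reach the level of `x` from above, one below it to go further down. -/
theorem IsAffineHovel.folded_step (hS : S.IsAffineHovel) (hA₁ : A₁ ∈ S.apartments)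
    (hA₂ : A₂ ∈ S.apartments) (hf₁ : f₁ ∈ S.isom A₁) (hf₂ : f₂ ∈ S.isom A₂)
    (hw : w ∈ 𝔸.weylGroup) (hagree : ∀ p, 0 ≤ 𝔸.simple w i (p -ᵥ m) → f₁ p = f₂ p)
    (hsep : ∀ p, f₁ p = f₂ p → 0 ≤ 𝔸.simple w i (p -ᵥ m)) {w' : V ≃ₗ[ℝ] V}
    (hw' : w' ∈ 𝔸.weylGroup) {c : V} (hc : c ∈ facetCone (𝔸.simple w') ∅) (x : P) :
    ∃ ε > 0, ∀ s, 0 ≤ s → s ≤ ε →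
      𝔸.simple w i (x -ᵥ m) + s * 𝔸.simple w i c ≤ 0 →
      S.Folded f₁ f₂ w i m (𝔸.simple w i (x -ᵥ m) + s * 𝔸.simple w i c) →
      ∃ ε' > 0, ∀ s', 0 ≤ s' → s' ≤ ε' →
        𝔸.simple w i (x -ᵥ m) + s' * 𝔸.simple w i c < 0 →
        S.Folded f₁ f₂ w i m (𝔸.simple w i (x -ᵥ m) + s' * 𝔸.simple w i c) := by
  have hne : (facetCone (-𝔸.simple w) {i}).Nonempty := by
    obtain ⟨v, hv⟩ := 𝔸.simple_cone_nonempty w {i}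
    exact ⟨_, neg_smul_mem_facetCone_neg hv one_pos⟩
  have hw'' : w * 𝔸.refl i ∈ 𝔸.weylGroup := mul_mem hw (𝔸.refl_mem i)
  set G := 𝔸.chimneyGerm (𝔸.facet x (facetCone (𝔸.simple w') ∅))
    (facetCone (-𝔸.simple w) {i}) with hG
  have hsplayed : 𝔸.IsSplayedChimneyGerm G :=
    ⟨x, _, _, ⟨∅, 𝔸.isFacetOfType_facetCone hw' ∅⟩, ⟨{i}, 𝔸.finite_parabolic_singleton i,
      𝔸.isFacetOfType_facetCone_neg hw {i}⟩, rfl⟩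
  have hsolid : 𝔸.IsSolidChimneyGerm G :=
    ⟨x, _, _, ⟨∅, 𝔸.isFacetOfType_facetCone hw' ∅⟩, ⟨{i}, 𝔸.isFacetOfType_facetCone_neg hw {i}⟩,
      ModelApartment.isSolid_chimney hne x, rfl⟩
  have hlevel : ∀ ξ ∈ closure (facetCone (-𝔸.simple w) {i}), ∀ (s : ℝ) (n : P),
      𝔸.simple w i ((s • c +ᵥ (ξ +ᵥ x)) -ᵥ n) = 𝔸.simple w i (x -ᵥ n) + s * 𝔸.simple w i c := by
    intro ξ hξ s n
    have h0 : 𝔸.simple w i ξ = 0 := by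
      simpa using (closure_facetCone_subset _ _ hξ).1 i rfl
    rw [vadd_vsub_assoc, vadd_vsub_assoc, map_add, map_add, map_smul, h0, smul_eq_mul]
    ring
  obtain ⟨B', hB', hB'Q, hB'G⟩ := hS.ma3
    (map f₁ (ModelApartment.sectorGerm (facetCone (𝔸.simple (w * 𝔸.refl i)) ∅))) (map f₂ G)
    ⟨A₁, hA₁, f₁, hf₁, _, ModelApartment.isSplayed_sectorGerm hw'', rfl⟩
    (Or.inr ⟨A₂, hA₂, f₂, hf₂, G, hsolid, rfl⟩)
  obtain ⟨ξ, hξ, ε, hε, hB'mem⟩ :=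
    ModelApartment.exists_of_mem_chimneyGerm hne (mem_map.1 hB'G) hc
  refine ⟨ε, hε, fun s hs hsε hs0 hfold => ?_⟩
  have hK := fun p => hS.mem_of_folded hw hs0 hfold hB' hB'Q (hlevel ξ hξ s m)
    (hB'mem s hs hsε) (p := p)
  have hwall : ∀ v, (∀ j, 0 ≤ 𝔸.simple w j v) → 𝔸.simple w i v = 0 → f₂ (-v +ᵥ m) ∈ B' := by
    intro v hv hv0
    refine hK _ (fun j => ?_) ?_
    · simpa using hv j
    · simpa [hv0] using hs0
  have hm : f₂ m ∈ B' := by simpa using hwall 0 (by simp) (by simp)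
  -- `B'` now shares with `A₂` both the chimney germ and the point `m`, hence an enclosed set `T`
  -- containing them.
  obtain ⟨⟨T, hTG, hmT, hT, hTB'⟩, -⟩ := hS.exists_shared hA₂ hB' hf₂ hsplayed hB'G hm
  obtain ⟨ξ', hξ', ε', hε', hTmem⟩ := ModelApartment.exists_of_mem_chimneyGerm hne hTG hc
  refine ⟨ε', hε', fun s' hs' hsε' hs0' => ?_⟩
  set t' := 𝔸.simple w i (x -ᵥ m) + s' * 𝔸.simple w i c with ht'
  have hK' : ∀ p, (∀ j, 𝔸.simple w j (p -ᵥ m) ≤ 0) → t' ≤ 𝔸.simple w i (p -ᵥ m) →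
      f₂ p ∈ B' := by
    intro p hp hpt
    refine hTB' p (hT.mem_of_panel hw (hTmem s' hs' hsε') hmT hp ?_)
    rw [← vsub_sub_vsub_cancel_right p _ m, map_sub, hlevel ξ' hξ' s' m]
    linarith
  obtain ⟨f₂', hf₂', hf₂f₂'⟩ := hS.exists_chart hA₂ hB' hf₂ hsplayed
    (ModelApartment.isRigid_chimneyGerm hne x) hB'G
  obtain ⟨g, hg, hgf, -⟩ := hS.exists_sector_chart hA₁ hB' hf₁ hw'' hB'Q
  obtain ⟨u, hu, hug⟩ := (S.isom_iff B' hB' g hg f₂').1 hf₂'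
  -- On the opposite closed panel at `m`, which lies in the wall, `f₁` and `f₂` agree with values in
  -- `B'`; so do the two charts of `B'`.
  have hufix : ∀ v, (∀ j, 0 ≤ 𝔸.simple w j v) → 𝔸.simple w i v = 0 → u (-v +ᵥ m) = -v +ᵥ m := by
    intro v hv hv0
    have h1 := hwall v hv hv0
    have h2 : f₁ (-v +ᵥ m) = f₂ (-v +ᵥ m) := hagree _ (by simp [hv0])
    have h3 := hgf _ (h2 ▸ h1)
    have h4 := congrFun hug (-v +ᵥ m)
    rw [hf₂f₂' _ h1, ← h2, ← h3] at h4
    exact (isom_injective hB' hg h4).symm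
  have hum : u m = m := by simpa using hufix 0 (by simp) (by simp)
  have hulin : ∀ v ∈ facetCone (𝔸.simple w) {i}, u.linear v = v := by
    intro v hv
    have h1 := hufix v (facetCone_nonneg hv) (hv.1 i rfl)
    rw [AffineEquiv.map_vadd, hum] at h1
    simpa using vadd_right_cancel _ h1
  have huapply : ∀ p, u p = u.linear (p -ᵥ m) +ᵥ m := by
    intro p
    conv_lhs => rw [← vsub_vadd p m, AffineEquiv.map_vadd, hum]
  refine ⟨B', hB', hB'Q, g, hg, hgf, fun p hp hpt => ?_⟩
  rw [← hf₂f₂' p (hK' p hp hpt), hug, Function.comp_apply]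
  rcases 𝔸.eq_one_or_eq_rootRefl hw (𝔸.linear_mem_weylGroup hu) hulin with h1 | h1
  · exfalso
    obtain ⟨d, hd⟩ := 𝔸.simple_cone_nonempty w ∅
    obtain ⟨v, hv⟩ := 𝔸.simple_cone_nonempty w {i}
    have hdi : 0 < 𝔸.simple w i d := hd.2 i (by simp)
    obtain ⟨q, hq, hqt⟩ : ∃ q : P, (∀ j, 𝔸.simple w j (q -ᵥ m) ≤ 0) ∧
        𝔸.simple w i (q -ᵥ m) = t' := by
      refine ⟨(t' / 𝔸.simple w i d) • d +ᵥ m, fun j => ?_, ?_⟩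
      · rw [vadd_vsub, map_smul]
        exact mul_nonpos_of_nonpos_of_nonneg (div_nonpos_of_nonpos_of_nonneg hs0'.le hdi.le)
          (facetCone_nonneg hd j)
      · rw [vadd_vsub, map_smul, smul_eq_mul, div_mul_cancel₀ _ hdi.ne']
    have huq : u q = q := by
      rw [huapply, h1]
      exact vsub_vadd q m
    have h2 : f₂ q = g q := by
      rw [← hf₂f₂' q (hK' q hq hqt.ge), hug, Function.comp_apply, huq]
    -- If `u` were the identity, `f₂ q = g q` at a level `t' < 0`. For `N` large, `q` lies in the
    -- sector issued from the wall point `m - N v` towards the centre, so `f₁ q ∈ B'` and `f₁ q = g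
    -- q = f₂ q`, contrary to `hsep`.
    obtain ⟨N, hN, h3⟩ := exists_forall_nonneg_add_mul
      (fun j => 𝔸.simple (w * 𝔸.refl i) j (q -ᵥ m)) (fun j => 𝔸.simple w j v) {i} hv.2
    have hNv : ∀ j, 0 ≤ 𝔸.simple w j (N • v) := fun j => by
      simpa using mul_nonneg hN (facetCone_nonneg hv j)
    have hNv0 : 𝔸.simple w i (N • v) = 0 := by simp [hv.1 i rfl]
    have h4 : f₁ (-(N • v) +ᵥ m) ∈ B' := by
      rw [hagree _ (by simp [hv.1 i rfl])]
      exact hwall _ hNv hNv0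
    have h5 : f₁ q ∈ B' := by
      refine hS.mem_of_sector hA₁ hB' hf₁ hw'' hB'Q h4 fun j => ?_
      rw [vsub_vadd_eq_vsub_sub, map_sub, map_neg, 𝔸.simple_mul_refl_of_eq_zero w i j hNv0,
        sub_neg_eq_add]
      by_cases hj : j = i
      · rw [hj, hNv0, 𝔸.simple_mul_refl_self, hqt]
        linarith
      · simpa using h3 N le_rfl j hj
    have h6 := hsep q ((hgf q h5).symm.trans h2.symm)
    linarith
  · rw [huapply, h1, ModelApartment.wallRefl_apply]

theorem IsAffineHovel.folded (hS : S.IsAffineHovel) (hA₁ : A₁ ∈ S.apartments)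
    (hA₂ : A₂ ∈ S.apartments) (hf₁ : f₁ ∈ S.isom A₁) (hf₂ : f₂ ∈ S.isom A₂)
    (hw : w ∈ 𝔸.weylGroup) (hagree : ∀ p, 0 ≤ 𝔸.simple w i (p -ᵥ m) → f₁ p = f₂ p)
    (hsep : ∀ p, f₁ p = f₂ p → 0 ≤ 𝔸.simple w i (p -ᵥ m)) {t : ℝ} (ht : t ≤ 0) :
    S.Folded f₁ f₂ w i m t := by
  have hw'' : w * 𝔸.refl i ∈ 𝔸.weylGroup := mul_mem hw (𝔸.refl_mem i)
  obtain ⟨c, hc⟩ := 𝔸.simple_cone_nonempty w ∅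
  have hci : 0 < 𝔸.simple w i c := hc.2 i (by simp)
  obtain ⟨d, hd⟩ := 𝔸.simple_cone_nonempty (w * 𝔸.refl i) ∅
  have hdi : 𝔸.simple w i d < 0 := by
    have := hd.2 i (by simp)
    rw [𝔸.simple_mul_refl_self] at this
    linarith
  have hpoint : ∀ t : ℝ, 𝔸.simple w i (((t / 𝔸.simple w i c) • c +ᵥ m) -ᵥ m) = t := fun t => by
    rw [vadd_vsub, map_smul, smul_eq_mul, div_mul_cancel₀ _ hci.ne']
  refine forall_nonpos_of_steps (E := S.Folded f₁ f₂ w i m) ?_ (fun t ht => ?_)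
    (fun t ht hE => ?_) t ht
  · refine ⟨A₁, hA₁, mem_map_isom hA₁ hf₁ _, f₁, hf₁, fun _ _ => rfl, fun p hp hp0 => ?_⟩
    rw [ModelApartment.wallRefl_apply,
      𝔸.rootRefl_of_simple_eq_zero w i (le_antisymm (hp i) hp0), vsub_vadd]
    exact (hagree p hp0).symm
  -- The base is turned upwards: the fold is known at a level `s` above and is deduced at the
  -- endpoint `0` of the germ.
  · obtain ⟨ε, hε, h⟩ := hS.folded_step hA₁ hA₂ hf₁ hf₂ hw hagree hsep hw hc
      ((t / 𝔸.simple w i c) • c +ᵥ m)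
    simp only [hpoint] at h
    refine ⟨ε * 𝔸.simple w i c, mul_pos hε hci, fun s hts hs hs0 hE => ?_⟩
    have he : t + (s - t) / 𝔸.simple w i c * 𝔸.simple w i c = s := by
      rw [div_mul_cancel₀ _ hci.ne']
      ring
    obtain ⟨ε', hε', h'⟩ := h ((s - t) / 𝔸.simple w i c) (div_nonneg (by linarith) hci.le)
      ((div_le_iff₀ hci).2 (by linarith)) (by rwa [he]) (by rwa [he])
    simpa using h' 0 le_rfl hε'.le (by simpa using ht)
  -- The base is turned downwards: the fold is known at the endpoint and is deduced at lower levels.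
  · obtain ⟨ε, hε, h⟩ := hS.folded_step hA₁ hA₂ hf₁ hf₂ hw hagree hsep hw'' hd
      ((t / 𝔸.simple w i c) • c +ᵥ m)
    simp only [hpoint] at h
    obtain ⟨ε', hε', h'⟩ := h 0 le_rfl hε.le (by simpa using ht) (by simpa using hE)
    refine ⟨ε' * -𝔸.simple w i d, mul_pos hε' (by linarith), fun s hs hst => ?_⟩
    have he : t + (s - t) / 𝔸.simple w i d * 𝔸.simple w i d = s := by
      rw [div_mul_cancel₀ _ hdi.ne]
      ring
    have := h' ((s - t) / 𝔸.simple w i d) (div_nonneg_of_nonpos (by linarith) hdi.le)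
      ((div_le_iff_of_neg hdi).2 (by linarith)) (by rw [he]; linarith)
    rwa [he] at this

/-- The retraction centred at a sector germ on the other side of the wall folds `A₂`. -/
theorem IsAffineHovel.retraction_apply (hS : S.IsAffineHovel) (hA₁ : A₁ ∈ S.apartments)
    (hA₂ : A₂ ∈ S.apartments) (hf₁ : f₁ ∈ S.isom A₁) (hf₂ : f₂ ∈ S.isom A₂)
    (hw : w ∈ 𝔸.weylGroup) (hagree : ∀ p, 0 ≤ 𝔸.simple w i (p -ᵥ m) → f₁ p = f₂ p)
    (hsep : ∀ p, f₁ p = f₂ p → 0 ≤ 𝔸.simple w i (p -ᵥ m)) {ρ : X → X}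
    (hρ : S.IsRetraction A₁
      (map f₁ (ModelApartment.sectorGerm (facetCone (𝔸.simple (w * 𝔸.refl i)) ∅))) ρ)
    {p : P} (hp : 𝔸.simple w i (p -ᵥ m) ≤ 0) : ρ (f₂ p) = f₁ (𝔸.wallRefl w i m p) := by
  have : Nonempty P := ⟨m⟩
  obtain ⟨v, hv⟩ := 𝔸.simple_cone_nonempty w {i}
  have hv0 : 𝔸.simple w i v = 0 := hv.1 i rfl
  obtain ⟨N, -, h⟩ := exists_forall_nonneg_add_mul (fun j => -𝔸.simple w j (p -ᵥ m))
    (fun j => 𝔸.simple w j v) {i} hv.2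
  -- move the base point along the wall so that `p` lies in the cone below it
  set n : P := N • v +ᵥ m with hn
  have hlevel : ∀ q : P, 𝔸.simple w i (q -ᵥ n) = 𝔸.simple w i (q -ᵥ m) := fun q => by
    rw [hn, vsub_vadd_eq_vsub_sub, map_sub, map_smul, hv0, smul_zero, sub_zero]
  have hrefl : 𝔸.wallRefl w i n p = 𝔸.wallRefl w i m p := by
    rw [ModelApartment.wallRefl_apply, ModelApartment.wallRefl_apply, hn, vsub_vadd_eq_vsub_sub,
      map_sub, 𝔸.rootRefl_of_simple_eq_zero w i (v := N • v) (by simp [hv0]), vadd_vadd,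
      sub_add_cancel]
  obtain ⟨B, hB, hBQ, g, hg, hgf, hfold⟩ := hS.folded (m := n) hA₁ hA₂ hf₁ hf₂ hw
    (fun q hq => hagree q (hlevel q ▸ hq)) (fun q hq => (hlevel q).symm ▸ hsep q hq) hp
  have h1 := hfold p (fun j => ?_) (hlevel p).ge
  · have h2 := hρ.eq_iso (f₂ p) B hB (h1 ▸ isom_mem hB hg _) hBQ _ (isIso_comp_invFun hB hf₁ hg)
      (eventually_comp_invFun hA₁ hB hf₁ hg hgf (mem_map_isom hA₁ hf₁ _) hBQ)
    rw [h2, h1, Function.comp_apply, Function.leftInverse_invFun (isom_injective hB hg), hrefl]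
  · by_cases hj : j = i
    · rw [hj, hlevel]
      exact hp
    · rw [hn, vsub_vadd_eq_vsub_sub, map_sub, map_smul, smul_eq_mul]
      linarith [h N le_rfl j hj]

end ApartmentSystem

end Masure

end

/-! ### Conclusion: the images of the two halves of `A₂`. -/

open Masure ApartmentSystem in
theorem proposition4p11 {V : Type*} [NormedAddCommGroup V] [NormedSpace ℝ V]
    [FiniteDimensional ℝ V] {P : Type*} [AddTorsor V P] {ι : Type*} [Fintype ι]
    (𝔸 : Masure.ModelApartment V P ι) {X : Type*} (S : Masure.ApartmentSystem 𝔸 X)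
    (hS : S.IsAffineHovel) (A₁ A₂ D : Set X)
    (hA₁ : A₁ ∈ S.apartments) (hA₂ : A₂ ∈ S.apartments)
    (hD : S.IsHalfApartment D) (hAD : A₁ ∩ A₂ = D) :
    ∃ Q : Filter X, S.IsIn 𝔸.IsSectorGerm A₁ Q ∧
      ∃ ρ : X → X, S.IsRetraction A₁ Q ρ ∧ ρ '' A₂ = D := by
  obtain ⟨A₀, hA₀, f₀, hf₀, _, ⟨_, ⟨w, hw, i, rfl⟩, m, -, rfl⟩, rfl⟩ := hD
  change A₁ ∩ A₂ = f₀ '' closedHalf (𝔸.simple w i) m at hAD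
  change ∃ Q : Filter X, _ ∧ ∃ ρ : X → X, _ ∧ ρ '' A₂ = f₀ '' closedHalf (𝔸.simple w i) m
  have hmem : f₀ '' closedHalf (𝔸.simple w i) m ∈
      map f₀ (ModelApartment.sectorGerm (facetCone (𝔸.simple w) ∅)) := by
    refine image_mem_map ((ModelApartment.mem_sectorGerm (𝔸.simple_cone_nonempty w ∅)).2
      ⟨m, fun v hv => ?_⟩)
    change 0 ≤ 𝔸.simple w i ((v +ᵥ m) -ᵥ m)
    rw [vadd_vsub]
    exact facetCone_nonneg hv i
  rw [← hAD] at hmem ⊢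
  have hinter : ∀ p, 0 ≤ 𝔸.simple w i (p -ᵥ m) → f₀ p ∈ A₁ ∩ A₂ := fun p hp =>
    hAD ▸ ⟨p, hp, rfl⟩
  obtain ⟨f₁, hf₁, h₁, -⟩ := hS.exists_sector_chart hA₀ hA₁ hf₀ hw
    (Filter.mem_of_superset hmem Set.inter_subset_left)
  obtain ⟨f₂, hf₂, h₂, -⟩ := hS.exists_sector_chart hA₀ hA₂ hf₀ hw
    (Filter.mem_of_superset hmem Set.inter_subset_right)
  have hagree₁ : ∀ p, 0 ≤ 𝔸.simple w i (p -ᵥ m) → f₁ p = f₀ p := fun p hp =>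
    h₁ p (hinter p hp).1
  have hagree₂ : ∀ p, 0 ≤ 𝔸.simple w i (p -ᵥ m) → f₂ p = f₀ p := fun p hp =>
    h₂ p (hinter p hp).2
  -- A common value lies in `A₁ ∩ A₂ = D`, where `f₁` coincides with `f₀`; injectivity of `f₁`
  -- places `p` in the half-space.
  have hsep : ∀ p, f₁ p = f₂ p → 0 ≤ 𝔸.simple w i (p -ᵥ m) := by
    intro p hp
    obtain ⟨q, hq, hqp⟩ : f₁ p ∈ f₀ '' closedHalf (𝔸.simple w i) m :=
      hAD ▸ ⟨isom_mem hA₁ hf₁ p, hp ▸ isom_mem hA₂ hf₂ p⟩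
    rwa [← isom_injective hA₁ hf₁ ((hagree₁ q hq).trans hqp)]
  obtain ⟨ρ, hρ⟩ := hS.exists_retraction hA₁ hf₁ (mul_mem hw (𝔸.refl_mem i))
  refine ⟨_, ⟨f₁, hf₁, _, ⟨_, 𝔸.isFacetOfType_facetCone (mul_mem hw (𝔸.refl_mem i)) ∅, rfl⟩, rfl⟩,
    ρ, hρ, Set.Subset.antisymm ?_ fun x hx => ⟨x, hx.2, hρ.eq_self x hx.1⟩⟩
  rintro _ ⟨x, hx, rfl⟩
  obtain ⟨p, rfl⟩ := exists_isom_eq hA₂ hf₂ hx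
  rcases le_total 0 (𝔸.simple w i (p -ᵥ m)) with hp | hp
  · rw [hagree₂ p hp, hρ.eq_self _ (hinter p hp).1]
    exact hinter p hp
  · rw [hS.retraction_apply hA₁ hA₂ hf₁ hf₂ hw
      (fun q hq => (hagree₁ q hq).trans (hagree₂ q hq).symm) hsep hρ hp]
    have h : 0 ≤ 𝔸.simple w i (𝔸.wallRefl w i m p -ᵥ m) := by
      rw [ModelApartment.wallRefl_apply, vadd_vsub, 𝔸.simple_rootRefl]
      linarith
    rw [hagree₁ _ h]
    exact hinter _ h
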